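/- Let $S^3\subset\mathbb R^4$ be the unit sphere with its surface measure, let $\sigma\in[0,\tfrac12)$, and let $(e_{n,k})_{n\ge1,\,1\le k\le n^2}$ be a Hilbert basis of the real space $L^2(S^3)$ such that $e_{n,k}$ is a spherical harmonic of degree $n-1$, so that $(1-\Delta_{S^3})e_{n,k}=n^2e_{n,k}$. Let $(p_m)_m$ be a sequence of real numbers $p_m\ge1$ with $p_m\to\infty$ such that, for some constant $C_0$, $\|e_{n,k}\|_{L^{p_m}(S^3)}\le C_0\sqrt{p_m}$ for all $n,k,m$. Let $\kappa\in\mathbb R$. Then there are $C,c>0$, depending only on $\sigma,\kappa$, the basis and the sequence $(p_m)$, such that the following holds. Let $(a_{n,k})$, $(b_{n,k})$ be real random variables on a probability space, all jointly independent, with $E(e^{\gamma a_{n,k}})\le e^{\kappa\gamma^2}$ and $E(e^{\gamma b_{n,k}})\le e^{\kappa\gamma^2}$ for all $n,k$ and all $\gamma\in\mathbb R$. Let $(u_0^{n,k})$, $(u_1^{n,k})$ be real numbers, not all zero, with $\sum_{n,k}n^{2\sigma}(u_0^{n,k})^2<\infty$ and $\sum_{n,k}n^{2(\sigma-1)}(u_1^{n,k})^2<\infty$.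 Set $$u_0=\sum_{n,k}u_0^{n,k}a_{n,k}e_{n,k},\qquad u_1=\sum_{n,k}u_1^{n,k}b_{n,k}e_{n,k},$$ $$S^N=\sum_{n\ge N+1}\sum_k\Big(n^{2\sigma}(u_0^{n,k})^2+n^{2(\sigma-1)}(u_1^{n,k})^2\Big),\qquad S=S^0.$$ Let $U(T)$ be the flow of $\partial_T^2+1-\Delta_{S^3}$, that is $$U(T)\Big(\sum v_0^{n,k}e_{n,k},\sum v_1^{n,k}e_{n,k}\Big)=\sum\Big(\cos(nT)v_0^{n,k}+\frac{\sin(nT)}{n}v_1^{n,k}\Big)e_{n,k},$$ and let $\Pi_N$ be the orthogonal projection of $L^2(S^3)$ on the span of the $e_{n,k}$ with $n\le N$. Then $(u_0,u_1)\in H^\sigma\times H^{\sigma-1}$ almost surely, and: 1. for all $\lambda>0$, all $N\ge0$ and all $m$, $$P\Big(\Big\|\frac{1}{1+|T|^{2/p_m}}(1-\Pi_N)U(T)(u_0,u_1)\Big\|_{L^{p_m}(\mathbb R\times S^3)}\ge\lambda\Big)\le\Big(\frac{C\,p_m\sqrt{S^N}}{\lambda}\Big)^{p_m};$$ 2. for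 all $\lambda\ge0$, $$P\Big(\Big\|\frac{1}{1+|T|^{2/3}}U(T)(u_0,u_1)\Big\|_{L^3_TL^6(S^3)}\ge\lambda\Big)\le Ce^{-c\lambda^2/S};$$ 3. for all $\lambda\ge0$ and all $M\ge1$, with $s=1$ if $\sigma=0$ and $s=0$ otherwise, $$P\Big(\Big\|\frac{1}{1+T^2}\Pi_MU(T)(u_0,u_1)\Big\|_{L^1_TL^\infty(S^3)}\ge\lambda\Big)\le Ce^{-c\lambda^2/(M^sS)}.$$ -/

import Mathlib

open MeasureTheory ProbabilityTheory Filter Topology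
open scoped ENNReal

noncomputable section

/-- The unit sphere `S³` of `ℝ⁴`. -/
abbrev S3 : Type := Metric.sphere (0 : EuclideanSpace ℝ (Fin 4)) 1

/-- The surface measure of `S³`. -/
def surf : Measure S3 := (volume : Measure (EuclideanSpace ℝ (Fin 4))).toSphere

instance : IsFiniteMeasure surf := by
  unfold surf; infer_instance

/-- The real Hilbert space `L²(S³)`. -/
abbrev L2S3 : Type := Lp ℝ 2 surf

/-- The pairs `(n, k)` with `n ≥ 1` and `n²` values of `k` (for `n = 0` there is no `k`). -/
abbrev ModeIdx : Type := (n : ℕ) × Fin (n ^ 2)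

/-- `f` is a spherical harmonic of degree `d`: the restriction to the sphere of a homogeneous
harmonic polynomial of degree `d` in four variables. -/
def IsSphericalHarmonic (d : ℕ) (f : L2S3) : Prop :=
  ∃ Q : MvPolynomial (Fin 4) ℝ, Q.IsHomogeneous d ∧
    ∑ j, MvPolynomial.pderiv j (MvPolynomial.pderiv j Q) = 0 ∧
    (f : S3 → ℝ) =ᵐ[surf] fun x => MvPolynomial.eval (fun j => x.1 j) Q

/-- The span of the `e_{n,k}` with `n ≤ N`. -/
def lowModes (e : HilbertBasis ModeIdx ℝ L2S3) (N : ℕ) : Submodule ℝ L2S3 :=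
  Submodule.span ℝ (e '' {i | i.1 ≤ N})

theorem finite_low (N : ℕ) : {i : ModeIdx | i.1 ≤ N}.Finite := by
  refine (((Finset.range (N + 1)).sigma fun n => (Finset.univ : Finset (Fin (n ^ 2))))
    |>.finite_toSet).subset ?_
  intro i hi
  have h : i.1 ≤ N := hi
  simp only [Finset.coe_sigma, Set.mem_sigma_iff, Finset.coe_range, Set.mem_Iio,
    Finset.coe_univ, Set.mem_univ, and_true]
  omega

instance (e : HilbertBasis ModeIdx ℝ L2S3) (N : ℕ) : FiniteDimensional ℝ (lowModes e N) :=
  FiniteDimensional.span_of_finite ℝ ((finite_low N).image e)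

/-- `Π_N`, the orthogonal projection of `L²(S³)` on the span of the `e_{n,k}` with `n ≤ N`. -/
def lowProj (e : HilbertBasis ModeIdx ℝ L2S3) (N : ℕ) : L2S3 →L[ℝ] L2S3 :=
  (lowModes e N).starProjection

/-- Membership in `H^s(S³)` of the distribution with coefficients `v` in the basis; the
eigenvalue of `1 - Δ` on `e_{n,k}` is `n²`. -/
def MemSobolev (s : ℝ) (v : ModeIdx → ℝ) : Prop :=
  Summable fun i : ModeIdx => (i.1 : ℝ) ^ (2 * s) * v i ^ 2

/-- The flow `U(T)` of `∂_T² + 1 - Δ`, applied to the data with coefficients `v₀`, `v₁`.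
The series converges in `L²(S³)` for data in `H^σ × H^{σ-1}`, `σ ≥ 0`. -/
def linFlow (e : HilbertBasis ModeIdx ℝ L2S3) (v₀ v₁ : ModeIdx → ℝ) (T : ℝ) : L2S3 :=
  ∑' i : ModeIdx,
    (Real.cos (i.1 * T) * v₀ i + Real.sin (i.1 * T) / i.1 * v₁ i) • e i

/-- `S^N`, the sum over `n ≥ N + 1` and `k` of
`n^{2σ} (u₀^{n,k})² + n^{2(σ-1)} (u₁^{n,k})²`; the total sum `S` is `tailSum σ u₀ u₁ 0`. -/
def tailSum (σ : ℝ) (u₀ u₁ : ModeIdx → ℝ) (N : ℕ) : ℝ :=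
  ∑' i : ModeIdx, if N < i.1 then
    (i.1 : ℝ) ^ (2 * σ) * u₀ i ^ 2 + (i.1 : ℝ) ^ (2 * (σ - 1)) * u₁ i ^ 2 else 0

/-- The norm of `(1 + |T|^δ)⁻¹ F(T)` in `L^r_T(ℝ, L^q(S³))`, in `[0, ∞]`. -/
def weightedNorm (δ : ℝ) (r q : ℝ≥0∞) (F : ℝ → L2S3) : ℝ≥0∞ :=
  eLpNorm (fun T : ℝ => eLpNorm (fun x : S3 => 1 / (1 + |T| ^ δ) * F T x) q surf) r volume

/-- For `r = q` the mixed norm is the norm of `L^q(ℝ × S³)`. -/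
theorem weightedNorm_eq_prod (δ : ℝ) {q : ℝ≥0∞} (hq : q ≠ 0) (hq' : q ≠ ∞) (F : ℝ → L2S3)
    (g : ℝ × S3 → ℝ) (hg : AEStronglyMeasurable g (volume.prod surf))
    (hF : ∀ᵐ T : ℝ, (F T : S3 → ℝ) =ᵐ[surf] fun x => g (T, x)) :
    weightedNorm δ q q F =
      eLpNorm (fun z : ℝ × S3 => 1 / (1 + |z.1| ^ δ) * g z) q (volume.prod surf) := by
  have hm : AEStronglyMeasurable (fun z : ℝ × S3 => 1 / (1 + |z.1| ^ δ) * g z)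
      (volume.prod surf) := by
    refine AEStronglyMeasurable.mul (Measurable.aestronglyMeasurable ?_) hg
    fun_prop
  have h0 : q.toReal ≠ 0 := (ENNReal.toReal_pos hq hq').ne'
  unfold weightedNorm
  rw [eLpNorm_eq_lintegral_rpow_enorm_toReal hq hq', eLpNorm_eq_lintegral_rpow_enorm_toReal hq hq',
    lintegral_prod _ (hm.enorm.pow_const _)]
  congr 1
  refine lintegral_congr_ae ?_
  filter_upwards [hF] with T hT
  rw [eLpNorm_eq_lintegral_rpow_enorm_toReal hq hq', enorm_eq_self, ← ENNReal.rpow_mul,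
    one_div_mul_cancel h0, ENNReal.rpow_one]
  refine lintegral_congr_ae ?_
  filter_upwards [hT] with x hx
  simp only [hx]

end

/-! ### Tools for Lebesgue norms -/

/-! At a fixed point $(T,x)$ a finite partial sum of the flow is a linear combination of independent
subgaussian variables. Its variance proxy is at most a constant times $\sum_i d_i\,e_i(x)^2$, with
$d_i=(u_0^i)^2+(u_1^i/n)^2$, uniformly in $T$. Hence its $L^q(P)$ norm is $O(\sqrt q)$ times the
square root of that sum (`eLpNorm_flowSum_le`).

For $q\ge r$, Minkowski's inequality moves $L^q(P)$ inside $L^r_{T,x}$, and the triangle inequality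
in $L^{r/2}$ (for $r\ge2$; smaller $r$ by Hölder) reduces the space norm to the $L^r$ norms of the
$e_i$. The time weight is dominated by the finite measure $dT/(1+T^2)$. The outcome is
`eLpNorm_mixedNorm_flowSum_le`: the $q$-th moment of the norm is $O(\sqrt q\,\sqrt{\sum_i d_i})$.
Fatou's lemma carries this to the full series.

Claim 1 is Markov's inequality with $q=r=p_m$. One factor $\sqrt{p_m}$ comes from the moment, the
other from the bound of the basis. Claim 2 keeps $r=6$ fixed and optimises over $q$, so growth
$\sqrt q$ becomes a Gaussian tail (`measure_ge_le_exp_of_eLpNorm_le`).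

Claim 3 needs a sup norm. A Nikolskii inequality bounds it, for polynomials of degree at most $D$,
by $(D+1)^{2/k}$ times the $L^{2k}$ norm, where $k$ is free (`exists_eLpNorm_top_polyS_le`). If
$\sigma>0$, the sum is cut into dyadic blocks and $k$ is taken so large that the loss
$2^{j\sigma/2}$ is beaten by the gain $2^{-j\sigma}$ from the Sobolev weight. If $\sigma=0$ there is
no gain, and a single block with $k=4$ costs $\sqrt M$, hence $M^s$ in the exponential. -/

theorem eLpNorm_ofReal_rpow {α ε : Type*} [MeasurableSpace α] [ENorm ε] {μ : Measure α} (f : α → ε)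
    {q : ℝ} (hq : 0 < q) :
    eLpNorm f (ENNReal.ofReal q) μ ^ q = ∫⁻ a, ‖f a‖ₑ ^ q ∂μ := by
  rw [eLpNorm_eq_lintegral_rpow_enorm_toReal (by simpa using hq) ENNReal.ofReal_ne_top,
    ENNReal.toReal_ofReal hq.le, ← ENNReal.rpow_mul, one_div_mul_cancel hq.ne', ENNReal.rpow_one]

theorem eLpNorm_ofReal_eq {α ε : Type*} [MeasurableSpace α] [ENorm ε] {μ : Measure α} (f : α → ε)
    {q : ℝ} (hq : 0 < q) :
    eLpNorm f (ENNReal.ofReal q) μ = (∫⁻ a, ‖f a‖ₑ ^ q ∂μ) ^ (1 / q) := by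
  rw [eLpNorm_eq_lintegral_rpow_enorm_toReal (by simpa using hq) ENNReal.ofReal_ne_top,
    ENNReal.toReal_ofReal hq.le]

theorem ENNReal.rpow_liminf {ι : Type*} {l : Filter ι} (u : ι → ℝ≥0∞) {s : ℝ} (hs : 0 < s) :
    (liminf u l) ^ s = liminf (fun n => u n ^ s) l :=
  OrderIso.liminf_apply (ENNReal.orderIsoRpow s hs)

theorem eLpNorm_liminf_le {α : Type*} [MeasurableSpace α] {μ : Measure α} {g : ℕ → α → ℝ≥0∞}
    (hg : ∀ n, Measurable (g n)) {s : ℝ} (hs : 0 < s) :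
    eLpNorm (fun a => liminf (fun n => g n a) atTop) (ENNReal.ofReal s) μ ≤
      liminf (fun n => eLpNorm (g n) (ENNReal.ofReal s) μ) atTop := by
  rw [← ENNReal.rpow_le_rpow_iff hs, ENNReal.rpow_liminf _ hs, eLpNorm_ofReal_rpow _ hs]
  simp only [eLpNorm_ofReal_rpow _ hs, enorm_eq_self, ENNReal.rpow_liminf _ hs]
  exact lintegral_liminf_le fun n => (hg n).pow_const s

/-- A subsequence converges almost everywhere, and Fatou's lemma applies along it. The exponent `q`
is unrelated to the 2 of the convergence. -/
theorem eLpNorm_le_of_tendsto_Lp {α : Type*} [MeasurableSpace α] {μ : Measure α}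
    {f : ℕ → Lp ℝ 2 μ} {F : Lp ℝ 2 μ} (h : Tendsto f atTop (𝓝 F)) (q c : ℝ≥0∞)
    (hc : ∀ n, eLpNorm (f n) q μ ≤ c) : eLpNorm F q μ ≤ c := by
  obtain ⟨ψ, -, hae⟩ := (tendstoInMeasure_of_tendsto_Lp h).exists_seq_tendsto_ae
  refine (Lp.eLpNorm_lim_le_liminf_eLpNorm (fun n => (Lp.aestronglyMeasurable (f (ψ n)))) _
    hae).trans ?_
  refine (liminf_le_liminf (Eventually.of_forall fun n => hc (ψ n))).trans ?_
  simp

/-- Any `c` above the liminf bounds the norms along a subsequence, which has the same limit. -/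
theorem eLpNorm_le_liminf_of_tendsto_Lp {α : Type*} [MeasurableSpace α] {μ : Measure α}
    {f : ℕ → Lp ℝ 2 μ} {F : Lp ℝ 2 μ} (h : Tendsto f atTop (𝓝 F)) (q : ℝ≥0∞) :
    eLpNorm F q μ ≤ liminf (fun n => eLpNorm (f n) q μ) atTop := by
  refine le_of_forall_gt_imp_ge_of_dense fun c hc => ?_
  obtain ⟨φ, hφ, hφc⟩ :=
    extraction_of_frequently_atTop (frequently_lt_of_liminf_lt (by isBoundedDefault) hc)
  exact eLpNorm_le_of_tendsto_Lp (h.comp hφ.tendsto_atTop) q c fun n => (hφc n).le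

/-- **Minkowski's integral inequality**, against a positive majorant. -/
theorem eLpNorm_eLpNorm_le {Ω X : Type*} [MeasurableSpace Ω] [MeasurableSpace X] {P : Measure Ω}
    {μ : Measure X} [SFinite P] [SFinite μ] {f : Ω → X → ℝ}
    (hf : Measurable (Function.uncurry f)) {H : X → ℝ≥0∞} (hH : Measurable H)
    (H0 : ∀ z, H z ≠ 0) (Htop : ∀ z, H z ≠ ∞) {r q : ℝ} (hr : 0 < r) (hrq : r ≤ q)
    (h : ∀ z, eLpNorm (fun ω => f ω z) (ENNReal.ofReal q) P ≤ H z) :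
    eLpNorm (fun ω => eLpNorm (f ω) (ENNReal.ofReal r) μ) (ENNReal.ofReal q) P ≤
      eLpNorm H (ENNReal.ofReal r) μ := by
  have hq : 0 < q := hr.trans_le hrq
  by_cases hA : eLpNorm H (ENNReal.ofReal r) μ = ∞
  · rw [hA]; exact le_top
  have hHr : Measurable fun z => H z ^ r := hH.pow_const r
  -- Under the measure $H^r\mu$ the quotient $f/H$ has $L^q(P)$ norm at most 1 at each point. Hölder
  -- from $r$ to $q$ on this finite measure and Tonelli then suffice, without duality. Dividing by
  -- `H` is what requires it to be nonzero and finite.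
  set ν := μ.withDensity fun z => H z ^ r with hν
  have hνu : ν Set.univ = eLpNorm H (ENNReal.ofReal r) μ ^ r := by
    rw [hν, withDensity_apply _ MeasurableSet.univ, Measure.restrict_univ,
      eLpNorm_ofReal_rpow _ hr]
    simp
  have hfe : Measurable (Function.uncurry fun ω z => ‖f ω z‖ₑ / H z) :=
    (hf.enorm).div (hH.comp measurable_snd)
  have hG : ∀ ω, Measurable fun z => ‖f ω z‖ₑ / H z := fun ω => hfe.of_uncurry_left
  have hcan : ∀ ω z, H z * (‖f ω z‖ₑ / H z) = ‖f ω z‖ₑ := fun ω z =>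
    ENNReal.mul_div_cancel (H0 z) (Htop z)
  have h1 : ∀ ω, eLpNorm (f ω) (ENNReal.ofReal r) μ =
      eLpNorm (fun z => ‖f ω z‖ₑ / H z) (ENNReal.ofReal r) ν := by
    intro ω
    rw [eLpNorm_ofReal_eq _ hr, eLpNorm_ofReal_eq _ hr, hν,
      lintegral_withDensity_eq_lintegral_mul _ hHr ((hG ω).enorm.pow_const r)]
    simp only [Pi.mul_apply, enorm_eq_self, ← ENNReal.mul_rpow_of_nonneg _ _ hr.le, hcan]
  have h2 : ∀ ω, eLpNorm (f ω) (ENNReal.ofReal r) μ ^ q ≤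
      (∫⁻ z, (‖f ω z‖ₑ / H z) ^ q ∂ν) * ν Set.univ ^ (q / r - 1) := by
    intro ω
    have := eLpNorm_le_eLpNorm_mul_rpow_measure_univ (μ := ν) (ENNReal.ofReal_le_ofReal hrq)
      (hG ω).aestronglyMeasurable
    rw [← h1, ENNReal.toReal_ofReal hr.le, ENNReal.toReal_ofReal hq.le] at this
    refine (ENNReal.rpow_le_rpow this hq.le).trans_eq ?_
    rw [ENNReal.mul_rpow_of_nonneg _ _ hq.le, eLpNorm_ofReal_rpow _ hq, ← ENNReal.rpow_mul]
    congr 2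
    field_simp
  have h3 : ∫⁻ ω, ∫⁻ z, (‖f ω z‖ₑ / H z) ^ q ∂ν ∂P ≤ ν Set.univ := by
    rw [lintegral_lintegral_swap (hfe.pow_const q).aemeasurable]
    refine (lintegral_mono (g := fun _ => 1) fun z => ?_).trans_eq (by simp)
    have hz : ∫⁻ ω, ‖f ω z‖ₑ ^ q ∂P ≤ H z ^ q := by
      rw [← eLpNorm_ofReal_rpow _ hq]
      exact ENNReal.rpow_le_rpow (h z) hq.le
    simp only [div_eq_mul_inv, ENNReal.mul_rpow_of_nonneg _ _ hq.le, ENNReal.inv_rpow]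
    rw [lintegral_mul_const _ ((hf.of_uncurry_right).enorm.pow_const q), ← div_eq_mul_inv]
    exact ENNReal.div_le_of_le_mul (by simpa using hz)
  rw [← ENNReal.rpow_le_rpow_iff hq, eLpNorm_ofReal_rpow _ hq]
  simp only [enorm_eq_self]
  refine (lintegral_mono h2).trans ?_
  rw [lintegral_mul_const' _ _ ?_]
  · refine (mul_le_mul_left h3 _).trans_eq ?_
    -- The powers of the total mass add up to $q/r$, and $\nu(X)^{q/r}=\|H\|_r^q$.
    nth_rewrite 1 [← ENNReal.rpow_one (ν Set.univ)]
    rw [← ENNReal.rpow_add_of_nonneg _ _ zero_le_one (by rw [sub_nonneg, le_div_iff₀ hr]; linarith),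
      hνu, ← ENNReal.rpow_mul]
    congr 1
    field_simp
    ring
  · rw [hνu]
    exact ENNReal.rpow_ne_top_of_nonneg (by rw [sub_nonneg, le_div_iff₀ hr]; linarith)
      (ENNReal.rpow_ne_top_of_nonneg hr.le hA)

/-! ### Moments and tails of subgaussian variables -/

/-- The function $y^qe^{-ty}$ is largest at $y=q/t$; this is $z\le e^{z-1}$ at $z=t|x|/q$, raised to
the power $q$. -/
theorem abs_rpow_le_exp {q : ℝ} (hq : 0 < q) {t : ℝ} (ht : 0 < t) (x : ℝ) :
    |x| ^ q ≤ (q / t) ^ q * Real.exp (-q) * (Real.exp (t * x) + Real.exp (-t * x)) := by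
  have h1 : t * |x| / q ≤ Real.exp (t * |x| / q - 1) := by
    have := Real.add_one_le_exp (t * |x| / q - 1); linarith
  have h2 : (t * |x| / q) ^ q ≤ Real.exp (t * |x| - q) := by
    refine (Real.rpow_le_rpow (by positivity) h1 hq.le).trans_eq ?_
    rw [← Real.exp_mul]; congr 1; field_simp
  have h3 : |x| = (q / t) * (t * |x| / q) := by field_simp
  calc |x| ^ q = (q / t) ^ q * (t * |x| / q) ^ q := by
        rw [← Real.mul_rpow (by positivity) (by positivity), ← h3]
    _ ≤ (q / t) ^ q * Real.exp (t * |x| - q) := by gcongr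
    _ = (q / t) ^ q * Real.exp (-q) * Real.exp (t * |x|) := by
        rw [mul_assoc, ← Real.exp_add]; ring_nf
    _ ≤ _ := by
        gcongr
        rcases abs_cases x with ⟨h, -⟩ | ⟨h, -⟩ <;> rw [h]
        · exact le_add_of_nonneg_right (Real.exp_pos _).le
        · rw [mul_neg, ← neg_mul]; exact le_add_of_nonneg_left (Real.exp_pos _).le

/-- With $t=\sqrt q/v$ both exponential moments are at most $e^{q/2}$, so $E|X|^q\le(\sqrt
q\,v)^q\cdot2e^{-q/2}$, and $2e^{-q/2}\le2^q$ since $q\ge1$. Asking for $c\le v^2$ with $v>0$ also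
covers a vanishing proxy. -/
theorem ProbabilityTheory.HasSubgaussianMGF.eLpNorm_le {Ω : Type*} [MeasurableSpace Ω]
    {P : Measure Ω} {X : Ω → ℝ} {c : NNReal} (hX : HasSubgaussianMGF X c P) {q v : ℝ}
    (hq : 1 ≤ q) (hv : 0 < v) (hc : (c : ℝ) ≤ v ^ 2) :
    eLpNorm X (ENNReal.ofReal q) P ≤ ENNReal.ofReal (2 * √q * v) := by
  have hq0 : 0 < q := by linarith
  set t := √q / v with ht
  have ht0 : 0 < t := by positivity
  have hqt : q / t = √q * v := by
    rw [ht]; field_simp; rw [Real.sq_sqrt hq0.le]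
  have hint := fun s => hX.integrable_exp_mul s
  have hmgf : ∀ s, s ^ 2 = t ^ 2 → ∫ ω, Real.exp (s * X ω) ∂P ≤ Real.exp (q / 2) := by
    intro s hs
    refine (hX.mgf_le s).trans (Real.exp_le_exp.2 ?_)
    rw [hs]
    have : v ^ 2 * t ^ 2 = q := by
      rw [ht, div_pow, Real.sq_sqrt hq0.le]; field_simp
    nlinarith [sq_nonneg t]
  rw [← ENNReal.rpow_le_rpow_iff hq0, eLpNorm_ofReal_rpow _ hq0,
    ENNReal.ofReal_rpow_of_nonneg (by positivity) hq0.le]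
  set A := (q / t) ^ q * Real.exp (-q) with hA
  have hA0 : 0 ≤ A := by positivity
  calc ∫⁻ ω, ‖X ω‖ₑ ^ q ∂P
      ≤ ∫⁻ ω, ENNReal.ofReal (A * (Real.exp (t * X ω) + Real.exp (-t * X ω))) ∂P := by
        refine lintegral_mono fun ω => ?_
        rw [Real.enorm_eq_ofReal_abs, ENNReal.ofReal_rpow_of_nonneg (abs_nonneg _) hq0.le]
        exact ENNReal.ofReal_le_ofReal (abs_rpow_le_exp hq0 ht0 _)
    _ = ENNReal.ofReal (∫ ω, A * (Real.exp (t * X ω) + Real.exp (-t * X ω)) ∂P) := by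
        refine (ofReal_integral_eq_lintegral_ofReal
          (((hint t).add (hint (-t))).const_mul A) ?_).symm
        exact Eventually.of_forall fun ω => mul_nonneg hA0 (by dsimp; positivity)
    _ ≤ ENNReal.ofReal ((2 * √q * v) ^ q) := by
        refine ENNReal.ofReal_le_ofReal ?_
        rw [integral_const_mul, integral_add (hint t) (hint (-t))]
        calc A * (∫ ω, Real.exp (t * X ω) ∂P + ∫ ω, Real.exp (-t * X ω) ∂P)
            ≤ A * (Real.exp (q / 2) + Real.exp (q / 2)) := by
              gcongr
              · exact hmgf t rfl
              · exact hmgf (-t) (by ring)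
          _ = (√q * v) ^ q * (2 * Real.exp (-q / 2)) := by
              rw [hA, hqt, ← two_mul, mul_assoc, mul_left_comm (Real.exp (-q)), ← Real.exp_add]
              ring_nf
          _ ≤ (√q * v) ^ q * 2 ^ q := by
              gcongr
              calc (2 : ℝ) * Real.exp (-q / 2) ≤ 2 ^ (1 : ℝ) * 1 := by
                    rw [Real.rpow_one]
                    gcongr
                    exact Real.exp_le_one_iff.2 (by linarith)
                _ ≤ 2 ^ q := by
                    rw [mul_one]; exact Real.rpow_le_rpow_of_exponent_le (by norm_num) hq
          _ = _ := by rw [← Real.mul_rpow (by positivity) (by positivity)]; ring_nf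

theorem measure_ge_le_of_eLpNorm_le {Ω : Type*} [MeasurableSpace Ω] {P : Measure Ω}
    {V : Ω → ℝ≥0∞} (hV : Measurable V) {q B lam : ℝ} (hq : 0 < q) (hB : 0 ≤ B) (hlam : 0 < lam)
    (h : eLpNorm V (ENNReal.ofReal q) P ≤ ENNReal.ofReal B) :
    P.real {ω | ENNReal.ofReal lam ≤ V ω} ≤ (B / lam) ^ q := by
  have := meas_ge_le_mul_pow_eLpNorm_enorm P (p := ENNReal.ofReal q) (by simpa using hq)
    ENNReal.ofReal_ne_top hV.aestronglyMeasurable (ε := ENNReal.ofReal lam) (by simpa using hlam)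
    (fun h => absurd h ENNReal.ofReal_ne_top)
  simp only [enorm_eq_self, ENNReal.toReal_ofReal hq.le] at this
  refine ENNReal.toReal_le_of_le_ofReal (by positivity) (this.trans ?_)
  rw [← ENNReal.ofReal_rpow_of_nonneg (by positivity) hq.le, div_eq_inv_mul,
    ENNReal.ofReal_mul (by positivity), ENNReal.ofReal_inv_of_pos hlam,
    ENNReal.mul_rpow_of_nonneg _ _ hq.le]
  gcongr

/-- Moments growing like `√q` give a Gaussian tail. -/
theorem measure_ge_le_exp_of_eLpNorm_le {Ω : Type*} [MeasurableSpace Ω] {P : Measure Ω}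
    [IsProbabilityMeasure P] {V : Ω → ℝ≥0∞} (hV : Measurable V) {r B : ℝ} (hr : 0 < r)
    (hB : 0 < B)
    (h : ∀ q, r ≤ q → eLpNorm V (ENNReal.ofReal q) P ≤ ENNReal.ofReal (B * √q)) {lam : ℝ}
    (hlam : 0 ≤ lam) :
    P.real {ω | ENNReal.ofReal lam ≤ V ω} ≤
      Real.exp r * Real.exp (-(Real.exp (-2) * lam ^ 2 / B ^ 2)) := by
  -- This choice makes $B\sqrt q/\lambda=e^{-1}$, so Markov's inequality gives $e^{-q}$. When $q<r$
  -- no moment bound is available, but then the factor $e^r$ makes the claim trivial.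
  set q := Real.exp (-2) * lam ^ 2 / B ^ 2 with hq
  rcases le_total q r with hqr | hqr
  · refine measureReal_le_one.trans ?_
    rw [← Real.exp_add]
    exact Real.one_le_exp (by linarith)
  · have hq0 : 0 < q := hr.trans_le hqr
    have hlam0 : 0 < lam := by
      rcases hlam.eq_or_lt with h0 | h0
      · rw [← h0] at hq; simp at hq; linarith
      · exact h0
    have hsq : √q = Real.exp (-1) * lam / B := by
      have : q = (Real.exp (-1) * lam / B) ^ 2 := by
        rw [hq, div_pow, mul_pow, ← Real.exp_nat_mul]; norm_num
      rw [this, Real.sqrt_sq (by positivity)]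
    refine (measure_ge_le_of_eLpNorm_le hV hq0 (by positivity) hlam0 (h q hqr)).trans ?_
    have : B * √q / lam = Real.exp (-1) := by rw [hsq]; field_simp
    rw [this, ← Real.exp_mul]
    calc Real.exp (-1 * q) = 1 * Real.exp (-q) := by ring_nf
      _ ≤ _ := by gcongr; exact Real.one_le_exp hr.le

theorem hasSubgaussianMGF_sum_mul {Ω ι : Type*} [MeasurableSpace Ω] {P : Measure Ω}
    {X : ι → Ω → ℝ} (hind : iIndepFun X P) {c : NNReal}
    (hX : ∀ i, HasSubgaussianMGF (X i) c P) (J : Finset ι) (w : ι → ℝ) :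
    HasSubgaussianMGF (fun ω => ∑ i ∈ J, w i * X i ω) (∑ i ∈ J, ⟨w i ^ 2, sq_nonneg _⟩ * c) P :=
  HasSubgaussianMGF.sum_of_iIndepFun
    (hind.comp (fun i x => w i * x) fun i => measurable_const_mul (w i))
    fun i _ => (hX i).const_mul (w i)

/-! ### Polynomials on the sphere -/

/-- The restriction to `S³` of the polynomials in four variables. -/
noncomputable def polyS : MvPolynomial (Fin 4) ℝ →ₐ[ℝ] C(S3, ℝ) :=
  MvPolynomial.aeval fun j => ⟨fun x : S3 => x.1 j, by fun_prop⟩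

theorem polyS_apply (Q : MvPolynomial (Fin 4) ℝ) (x : S3) :
    polyS Q x = MvPolynomial.eval (fun j => x.1 j) Q := by
  induction Q using MvPolynomial.induction_on with
  | C a => simp [polyS]
  | add p q hp hq => simp [hp, hq]
  | mul_X p j hp =>
    rw [map_mul, ContinuousMap.mul_apply, hp, map_mul, MvPolynomial.eval_X]
    simp [polyS]

instance : surf.IsOpenPosMeasure := by unfold surf; infer_instance

theorem surf_real_univ_pos : 0 < surf.real Set.univ := by
  have : surf ≠ 0 := Measure.toSphere_ne_zero _
  rw [measureReal_def]
  exact ENNReal.toReal_pos (by simpa using this) (measure_ne_top _ _)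

/-- The action of a linear isometry of `ℝ⁴` on `S³`. -/
noncomputable def sphereMap (f : EuclideanSpace ℝ (Fin 4) ≃ₗᵢ[ℝ] EuclideanSpace ℝ (Fin 4)) (x : S3) : S3 :=
  ⟨f x.1, by simp⟩

/-- The surface measure of a set is a multiple of the volume of the cone over it; an isometry sends
cones to cones and preserves volume. -/
theorem measurePreserving_sphereMap
    (f : EuclideanSpace ℝ (Fin 4) ≃ₗᵢ[ℝ] EuclideanSpace ℝ (Fin 4)) :
    MeasurePreserving (sphereMap f) surf surf := by
  have hc : Continuous (sphereMap f) := by unfold sphereMap; fun_prop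
  refine ⟨hc.measurable, Measure.ext fun s hs => ?_⟩
  rw [Measure.map_apply hc.measurable hs, surf, Measure.toSphere_apply' _ hs,
    Measure.toSphere_apply' _ (hc.measurable hs)]
  congr 1
  refine Eq.trans ?_
    (f.measurePreserving.measure_preimage_emb f.toHomeomorph.measurableEmbedding _)
  congr 1
  ext y
  simp only [Set.mem_smul, Set.mem_image, Set.mem_preimage, Subtype.exists]
  constructor
  · rintro ⟨t, ht, _, ⟨z, hz, hzs, rfl⟩, rfl⟩
    exact ⟨t, ht, f z, ⟨f z, (sphereMap f ⟨z, hz⟩).2, hzs, rfl⟩, by simp⟩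
  · rintro ⟨t, ht, _, ⟨z, hz, hzs, rfl⟩, hy⟩
    refine ⟨t, ht, f.symm z, ⟨f.symm z, by simpa using hz, ?_, rfl⟩, ?_⟩
    · simpa [sphereMap] using hzs
    · rw [← map_smul, hy, LinearIsometryEquiv.symm_apply_apply]

/-- The reflection in the hyperplane orthogonal to $x-y$ exchanges two vectors of equal norm. -/
theorem exists_sphereMap_eq (x y : S3) : ∃ f, sphereMap f x = y := by
  refine ⟨(Submodule.span ℝ {x.1 - y.1})ᗮ.reflection, Subtype.ext ?_⟩
  exact Submodule.reflection_sub (by simp)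

theorem totalDegree_aeval_le {σ τ : Type*} (g : σ → MvPolynomial τ ℝ)
    (hg : ∀ j, (g j).totalDegree ≤ 1) (Q : MvPolynomial σ ℝ) :
    (MvPolynomial.aeval g Q).totalDegree ≤ Q.totalDegree := by
  rw [MvPolynomial.aeval_def, MvPolynomial.eval₂_eq]
  refine (MvPolynomial.totalDegree_finsetSum _ _).trans (Finset.sup_le fun s hs => ?_)
  refine (MvPolynomial.totalDegree_mul _ _).trans ?_
  rw [MvPolynomial.algebraMap_eq, MvPolynomial.totalDegree_C, zero_add]
  refine (MvPolynomial.totalDegree_finsetProd _ _).trans ?_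
  refine (Finset.sum_le_sum fun i _ => ?_).trans (MvPolynomial.le_totalDegree hs)
  exact (MvPolynomial.totalDegree_pow _ _).trans (by nlinarith [hg i])

/-- A linear substitution does not raise the degree, so polynomials of bounded degree form a
rotation invariant space. -/
theorem exists_polyS_comp_sphereMap
    (f : EuclideanSpace ℝ (Fin 4) ≃ₗᵢ[ℝ] EuclideanSpace ℝ (Fin 4)) (Q : MvPolynomial (Fin 4) ℝ) :
    ∃ Q' : MvPolynomial (Fin 4) ℝ, Q'.totalDegree ≤ Q.totalDegree ∧
      ∀ x, polyS Q' x = polyS Q (sphereMap f x) := by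
  let b := EuclideanSpace.basisFun (Fin 4) ℝ
  let g : Fin 4 → MvPolynomial (Fin 4) ℝ := fun j =>
    ∑ l, MvPolynomial.C (f (b l) j) * MvPolynomial.X l
  refine ⟨MvPolynomial.aeval g Q, totalDegree_aeval_le g (fun j => ?_) Q, fun x => ?_⟩
  · refine (MvPolynomial.totalDegree_finsetSum _ _).trans (Finset.sup_le fun l _ => ?_)
    refine (MvPolynomial.totalDegree_mul _ _).trans ?_
    simp
  · have hx : f x.1 = ∑ l, x.1 l • f (b l) := by
      conv_lhs => rw [← b.sum_repr x.1]
      simp [b]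
    have hcomp : (MvPolynomial.aeval fun j => x.1 j).comp (MvPolynomial.aeval g) =
        (MvPolynomial.aeval (fun j => (sphereMap f x).1 j) : _ →ₐ[ℝ] ℝ) := by
      refine MvPolynomial.algHom_ext fun j => ?_
      simp only [AlgHom.comp_apply, sphereMap, hx, g, map_sum, map_mul, MvPolynomial.aeval_X,
        WithLp.ofLp_sum, Finset.sum_apply, WithLp.ofLp_smul, Pi.smul_apply, smul_eq_mul,
        MvPolynomial.aeval_C]
      exact Finset.sum_congr rfl fun l _ => mul_comm _ _
    rw [polyS_apply, polyS_apply]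
    exact DFunLike.congr_fun hcomp Q

/-- Exponents of monomials of degree at most $D$ lie in the box $\{0,\dots,D\}^4$. The crude power 4
produces the exponent $4/(2k)=2/k$ in the Nikolskii inequality. -/
theorem finrank_restrictTotalDegree_le (D : ℕ) :
    Module.finrank ℝ (MvPolynomial.restrictTotalDegree (Fin 4) ℝ D) ≤ (D + 1) ^ 4 := by
  let ι := {n : Fin 4 →₀ ℕ | (n.sum fun _ e => e) ≤ D}
  have hle : ∀ n : ι, ∀ j, n.1 j < D + 1 := fun n j => by
    have h1 : n.1 j ≤ n.1.sum fun _ e => e := by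
      rw [Finsupp.sum_fintype _ _ fun _ => rfl]
      exact Finset.single_le_sum (f := fun i => n.1 i) (fun _ _ => Nat.zero_le _)
        (Finset.mem_univ j)
    have h2 : (n.1.sum fun _ e => e) ≤ D := n.2
    omega
  let φ : ι → (Fin 4 → Fin (D + 1)) := fun n j => ⟨n.1 j, hle n j⟩
  have hφ : Function.Injective φ := fun n m h => by
    ext j
    simpa [φ] using congrArg Fin.val (congrFun h j)
  have : Finite ι := Finite.of_injective φ hφ
  rw [show Module.finrank ℝ (MvPolynomial.restrictTotalDegree (Fin 4) ℝ D) = Nat.card ι from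
    Module.finrank_eq_nat_card_basis (MvPolynomial.basisRestrictSupport ℝ _)]
  simpa using Nat.card_le_card_of_injective φ hφ

/-- The embedding of `C(S³)` in `L²(S³)`. -/
noncomputable def contToL2 : C(S3, ℝ) →L[ℝ] L2S3 := ContinuousMap.toLp 2 surf ℝ

theorem norm_contToL2_sq (f : C(S3, ℝ)) : ‖contToL2 f‖ ^ 2 = ∫ x, f x ^ 2 ∂surf := by
  rw [← real_inner_self_eq_norm_sq, L2.inner_def]
  refine integral_congr_ae ?_
  filter_upwards [ContinuousMap.coeFn_toLp (p := 2) (𝕜 := ℝ) surf f] with x hx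
  have : (contToL2 f : S3 → ℝ) x = f x := hx
  simp [this, sq]

theorem integrable_continuousMap (f : C(S3, ℝ)) : Integrable (fun x => f x) surf :=
  f.continuous.integrable_of_hasCompactSupport (HasCompactSupport.of_compactSpace _)

/-- The bound of the sup norm by the `L²` norm for polynomials of bounded degree on `S³`. -/
theorem polyS_sq_le {D : ℕ} {Q : MvPolynomial (Fin 4) ℝ} (hQ : Q.totalDegree ≤ D) (x : S3) :
    polyS Q x ^ 2 * surf.real Set.univ ≤ ((D : ℝ) + 1) ^ 4 * ∫ y, polyS Q y ^ 2 ∂surf := by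
  let V := MvPolynomial.restrictTotalDegree (Fin 4) ℝ D
  let ℓ : MvPolynomial (Fin 4) ℝ →ₗ[ℝ] L2S3 := contToL2.toLinearMap ∘ₗ polyS.toLinearMap
  let W : Submodule ℝ L2S3 := V.map ℓ
  have : FiniteDimensional ℝ W := inferInstanceAs (Module.Finite ℝ (V.map ℓ))
  have hd : (Module.finrank ℝ W : ℝ) ≤ ((D : ℝ) + 1) ^ 4 := by
    exact_mod_cast (Submodule.finrank_map_le ℓ V).trans (finrank_restrictTotalDegree_le D)
  let b := stdOrthonormalBasis ℝ W
  have hb : ∀ j, ∃ q ∈ V, ℓ q = b j := fun j => (b j).2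
  choose q hqV hq using hb
  have hnorm : ∀ c : Fin (Module.finrank ℝ W) → ℝ, ‖ℓ (∑ j, c j • q j)‖ ^ 2 = ∑ j, c j ^ 2 := by
    intro c
    have : ℓ (∑ j, c j • q j) = ((∑ j, c j • b j : W) : L2S3) := by
      simp [hq]
    rw [this, ← Submodule.coe_norm, ← real_inner_self_eq_norm_sq, b.orthonormal.inner_sum]
    simp [sq]
  -- Continuous functions equal almost everywhere are equal, so elements of `W` have well defined
  -- point values.
  have hinj : ∀ Q₁ Q₂ : MvPolynomial (Fin 4) ℝ, ℓ Q₁ = ℓ Q₂ → polyS Q₁ = polyS Q₂ :=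
    fun Q₁ Q₂ h => ContinuousMap.toLp_injective (μ := surf) (p := 2) (𝕜 := ℝ) h
  have hev : ∀ (c : Fin (Module.finrank ℝ W) → ℝ) (y : S3),
      polyS (∑ j, c j • q j) y = ∑ j, c j * polyS (q j) y := by
    intro c y
    simp [ContinuousMap.sum_apply]
  -- The diagonal of the reproducing kernel of `W`. By Cauchy–Schwarz it bounds point values, it is
  -- constant by rotation invariance, and its integral is $\dim W$.
  set K : S3 → ℝ := fun y => ∑ j, polyS (q j) y ^ 2 with hK
  have hK0 : ∀ y, 0 ≤ K y := fun y => Finset.sum_nonneg fun _ _ => sq_nonneg _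
  have hCS : ∀ Q₁ ∈ V, ∀ y, polyS Q₁ y ^ 2 ≤ ‖ℓ Q₁‖ ^ 2 * K y := by
    intro Q₁ hQ₁ y
    let w : W := ⟨ℓ Q₁, Submodule.mem_map_of_mem hQ₁⟩
    let c := fun j => b.repr w j
    have h1 : ℓ Q₁ = ℓ (∑ j, c j • q j) := by
      have : ((∑ j, c j • b j : W) : L2S3) = ℓ Q₁ := congrArg Subtype.val (b.sum_repr w)
      rw [← this]
      simp [hq]
    rw [hinj _ _ h1, h1, hnorm, hev]
    exact Finset.sum_mul_sq_le_sq_mul_sq _ _ _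
  have hKle : ∀ y z, K z ≤ K y := by
    intro y z
    obtain ⟨f, hf⟩ := exists_sphereMap_eq y z
    -- The kernel section at $z$, for which both the value at $z$ and the squared norm equal $K(z)$.
    -- Rotated so that $y$ plays the role of $z$, it gives $K(z)^2\le K(z)K(y)$.
    let Q₁ := ∑ j, polyS (q j) z • q j
    have hQ₁ : Q₁ ∈ V := V.sum_mem fun j _ => V.smul_mem _ (hqV j)
    obtain ⟨Q', hQ', hc⟩ := exists_polyS_comp_sphereMap f Q₁
    have hQ'V : Q' ∈ V := (MvPolynomial.mem_restrictTotalDegree _ _ _).2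
      (hQ'.trans ((MvPolynomial.mem_restrictTotalDegree _ _ _).1 hQ₁))
    have h1 : polyS Q₁ z = K z := by rw [hev]; simp [hK, sq]
    have h2 : ‖ℓ Q'‖ ^ 2 = K z := by
      calc ‖ℓ Q'‖ ^ 2 = ∫ y, polyS Q' y ^ 2 ∂surf := norm_contToL2_sq _
        _ = ∫ y, polyS Q₁ (sphereMap f y) ^ 2 ∂surf := by simp only [hc]
        _ = ∫ y, polyS Q₁ y ^ 2 ∂(surf.map (sphereMap f)) := by
            rw [integral_map (measurePreserving_sphereMap f).measurable.aemeasurable]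
            exact ((polyS Q₁).continuous.pow 2).aestronglyMeasurable
        _ = ‖ℓ Q₁‖ ^ 2 := by
            rw [(measurePreserving_sphereMap f).map_eq]; exact (norm_contToL2_sq _).symm
        _ = K z := hnorm _
    have h3 := hCS Q' hQ'V y
    rw [hc, hf, h1, h2, sq] at h3
    rcases (hK0 z).eq_or_lt with h0 | h0
    · rw [← h0]; exact hK0 y
    · exact le_of_mul_le_mul_left h3 h0
  have hint : ∫ y, K y ∂surf = Module.finrank ℝ W := by
    rw [hK, integral_finsetSum]
    · have : ∀ j, ∫ y, polyS (q j) y ^ 2 ∂surf = 1 := fun j => by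
        rw [← norm_contToL2_sq]
        change ‖ℓ (q j)‖ ^ 2 = 1
        rw [hq, ← Submodule.coe_norm, b.orthonormal.1 j, one_pow]
      simp [this]
    · intro j _
      exact integrable_continuousMap (polyS (q j) ^ 2)
  have hKx : K x * surf.real Set.univ ≤ ((D : ℝ) + 1) ^ 4 := by
    have : ∀ y, K y = K x := fun y => le_antisymm (hKle _ _) (hKle _ _)
    simp only [this, integral_const, smul_eq_mul] at hint
    linarith
  have := hCS Q ((MvPolynomial.mem_restrictTotalDegree _ _ _).2 hQ) x
  have hn : ‖ℓ Q‖ ^ 2 = ∫ y, polyS Q y ^ 2 ∂surf := norm_contToL2_sq _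
  rw [← hn]
  have hv := surf_real_univ_pos
  nlinarith [sq_nonneg ‖ℓ Q‖]

/-- A Nikolskii inequality on `S³`, with a small exponent for large `k`. -/
theorem exists_eLpNorm_top_polyS_le {k : ℕ} (hk : 1 ≤ k) :
    ∃ K : ℝ, 0 < K ∧ ∀ (D : ℕ) (Q : MvPolynomial (Fin 4) ℝ), Q.totalDegree ≤ D →
      eLpNorm (polyS Q) ∞ surf ≤ ENNReal.ofReal (K * ((D : ℝ) + 1) ^ (2 / k : ℝ)) *
        eLpNorm (polyS Q) (ENNReal.ofReal (2 * k)) surf := by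
  have hv := surf_real_univ_pos
  set v := surf.real Set.univ with hvdef
  have hk0 : (0 : ℝ) < k := by exact_mod_cast hk
  have hk1 : (1 : ℝ) ≤ k := by exact_mod_cast hk
  refine ⟨((k : ℝ) ^ 4 / v) ^ (1 / (2 * k) : ℝ), by positivity, fun D Q hQ => ?_⟩
  set I := ∫ y, polyS Q y ^ (2 * k) ∂surf with hI
  have hI0 : 0 ≤ I := integral_nonneg fun y => (even_two_mul k).pow_nonneg _
  have hnorm : eLpNorm (polyS Q) (ENNReal.ofReal (2 * k)) surf =
      ENNReal.ofReal (I ^ (1 / (2 * k) : ℝ)) := by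
    rw [eLpNorm_ofReal_eq _ (by positivity), ← ENNReal.ofReal_rpow_of_nonneg hI0 (by positivity),
      hI, ofReal_integral_eq_lintegral_ofReal (f := fun y => polyS Q y ^ (2 * k))
        (integrable_continuousMap (polyS Q ^ (2 * k))) (Eventually.of_forall fun y =>
          (even_two_mul k).pow_nonneg _)]
    congr 1
    refine lintegral_congr fun y => ?_
    rw [Real.enorm_eq_ofReal_abs, ENNReal.ofReal_rpow_of_nonneg (abs_nonneg _) (by positivity),
      ← (even_two_mul k).pow_abs, ← Real.rpow_natCast]
    push_cast
    rfl
  rw [hnorm, ← ENNReal.ofReal_mul (by positivity), eLpNorm_exponent_top]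
  refine eLpNormEssSup_le_of_ae_bound (Eventually.of_forall fun x => ?_)
  -- The $L^2$ bound is applied to $Q^k$, of degree at most $kD$, and $(kD+1)^4\le k^4(D+1)^4$.
  -- Taking $2k$-th roots leaves the small power $2/k$ of $D+1$.
  have h1 := polyS_sq_le ((MvPolynomial.totalDegree_pow Q k).trans (Nat.mul_le_mul_left k hQ)) x
  simp only [map_pow, ContinuousMap.pow_apply, ← pow_mul, mul_comm k 2] at h1
  push_cast at h1
  have h2 : |polyS Q x| ^ (2 * k) ≤ ((k : ℝ) ^ 4 / v) * ((D : ℝ) + 1) ^ 4 * I := by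
    rw [(even_two_mul k).pow_abs, div_mul_eq_mul_div, div_mul_eq_mul_div, le_div_iff₀ hv]
    refine h1.trans ?_
    rw [← mul_pow]
    gcongr
    nlinarith
  have h3 : |polyS Q x| = (|polyS Q x| ^ (2 * k)) ^ (1 / (2 * k) : ℝ) := by
    rw [← Real.rpow_natCast, ← Real.rpow_mul (abs_nonneg _)]
    push_cast
    rw [mul_one_div_cancel (by positivity), Real.rpow_one]
  rw [Real.norm_eq_abs, h3]
  refine (Real.rpow_le_rpow (by positivity) h2 (by positivity)).trans_eq ?_
  rw [Real.mul_rpow (by positivity) hI0, Real.mul_rpow (by positivity) (by positivity)]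
  congr 2
  rw [← Real.rpow_natCast, ← Real.rpow_mul (by positivity)]
  congr 1
  push_cast
  field_simp
  norm_num

/-! ### Mixed norms of finite random sums -/

theorem measurable_eLpNorm_right {Ω X : Type*} [MeasurableSpace Ω] [MeasurableSpace X]
    {μ : Measure X} [SFinite μ] {f : Ω → X → ℝ} (hf : Measurable (Function.uncurry f)) {r : ℝ}
    (hr : 0 < r) : Measurable fun ω => eLpNorm (f ω) (ENNReal.ofReal r) μ := by
  simp only [eLpNorm_ofReal_eq _ hr]
  exact ((hf.enorm.pow_const r).lintegral_prod_right').pow_const _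

theorem measurable_eLpNorm_right_ennreal {Ω X : Type*} [MeasurableSpace Ω] [MeasurableSpace X]
    {μ : Measure X} [SFinite μ] {f : Ω → X → ℝ≥0∞} (hf : Measurable (Function.uncurry f)) {r : ℝ}
    (hr : 0 < r) : Measurable fun ω => eLpNorm (f ω) (ENNReal.ofReal r) μ := by
  simp only [eLpNorm_ofReal_eq _ hr]
  exact ((hf.enorm.pow_const r).lintegral_prod_right').pow_const _

theorem eLpNorm_prod_eq {X Y : Type*} [MeasurableSpace X] [MeasurableSpace Y]
    {μ : Measure X} {ν : Measure Y} [SFinite μ] [SFinite ν] {f : X → Y → ℝ}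
    (hf : Measurable (Function.uncurry f)) {r : ℝ} (hr : 0 < r) :
    eLpNorm (Function.uncurry f) (ENNReal.ofReal r) (μ.prod ν) =
      eLpNorm (fun x => eLpNorm (f x) (ENNReal.ofReal r) ν) (ENNReal.ofReal r) μ := by
  rw [eLpNorm_ofReal_eq _ hr, eLpNorm_ofReal_eq _ hr,
    lintegral_prod _ (hf.enorm.pow_const r).aemeasurable]
  simp only [enorm_eq_self, eLpNorm_ofReal_rpow _ hr, Function.uncurry_apply_pair]

/-- The measure `dT / (1 + T²)`. -/
noncomputable def cauchyWeight : Measure ℝ := volume.withDensity fun T => ENNReal.ofReal (1 + T ^ 2)⁻¹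

theorem cauchyWeight_univ : cauchyWeight Set.univ = ENNReal.ofReal Real.pi := by
  rw [cauchyWeight, withDensity_apply _ MeasurableSet.univ, Measure.restrict_univ,
    ← ofReal_integral_eq_lintegral_ofReal integrable_inv_one_add_sq
      (Eventually.of_forall fun T => by positivity), integral_univ_inv_one_add_sq]

instance : IsFiniteMeasure cauchyWeight := ⟨by rw [cauchyWeight_univ]; exact ENNReal.ofReal_lt_top⟩

/-- The norm of `L^s_T L^r_x` for the weight `dT / (1 + T²)`. -/
noncomputable def mixedNorm (s r : ℝ) (g : ℝ → S3 → ℝ) : ℝ≥0∞ :=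
  eLpNorm (fun T => eLpNorm (g T) (ENNReal.ofReal r) surf) (ENNReal.ofReal s) cauchyWeight

/-- Superadditivity of $y\mapsto y^s$ for $s\ge1$; the exponent $2/s$ is the one that turns
$|T|^{2/s}$ into $T^2$. -/
theorem one_div_one_add_rpow_le {s : ℝ} (hs : 1 ≤ s) (T : ℝ) :
    (1 / (1 + |T| ^ (2 / s))) ^ s ≤ (1 + T ^ 2)⁻¹ := by
  have hs0 : 0 < s := by linarith
  rw [one_div, Real.inv_rpow (by positivity)]
  refine inv_anti₀ (by positivity) ?_
  have := Real.add_rpow_le_rpow_add (a := 1) (b := |T| ^ (2 / s)) zero_le_one (by positivity) hs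
  rwa [Real.one_rpow, ← Real.rpow_mul (abs_nonneg _), div_mul_cancel₀ _ hs0.ne', Real.rpow_two,
    sq_abs] at this

/-- The measurable majorant `L` stands in for the norm of `F T`, so no measurability in $T$ is
required of `F`. -/
theorem weightedNorm_le {s : ℝ} (hs : 1 ≤ s) (q : ℝ≥0∞) {F : ℝ → L2S3} {L : ℝ → ℝ≥0∞}
    (hL : Measurable L) (h : ∀ T, eLpNorm (F T) q surf ≤ L T) :
    weightedNorm (2 / s) (ENNReal.ofReal s) q F ≤ eLpNorm L (ENNReal.ofReal s) cauchyWeight := by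
  have hs0 : 0 < s := by linarith
  rw [weightedNorm, eLpNorm_ofReal_eq _ hs0, eLpNorm_ofReal_eq _ hs0, cauchyWeight,
    lintegral_withDensity_eq_lintegral_mul _ (by fun_prop) (hL.enorm.pow_const s)]
  refine ENNReal.rpow_le_rpow (lintegral_mono fun T => ?_) (by positivity)
  have : eLpNorm (fun x : S3 => 1 / (1 + |T| ^ (2 / s)) * F T x) q surf =
      ‖1 / (1 + |T| ^ (2 / s))‖ₑ * eLpNorm (F T) q surf :=
    eLpNorm_const_smul (1 / (1 + |T| ^ (2 / s))) (F T : S3 → ℝ) q surf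
  simp only [this, enorm_eq_self, Pi.mul_apply]
  rw [ENNReal.mul_rpow_of_nonneg _ _ hs0.le]
  gcongr
  · rw [Real.enorm_eq_ofReal (by positivity), ENNReal.ofReal_rpow_of_nonneg (by positivity) hs0.le]
    exact ENNReal.ofReal_le_ofReal (one_div_one_add_rpow_le hs T)
  · exact h T

/-- Squaring turns the $L^r$ norm into an $L^{r/2}$ norm, where the triangle inequality holds
because $r\ge2$. The added `D` keeps the function positive, as a divisor in Minkowski's inequality
must be, and costs only the term `m`. -/
theorem eLpNorm_sqrt_sum_le {X ι : Type*} [MeasurableSpace X] {μ : Measure X} [IsFiniteMeasure μ]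
    {ψ : ι → X → ℝ} (hψ : ∀ i, Measurable (ψ i)) (J : Finset ι) {d : ι → ℝ} (hd : ∀ i, 0 ≤ d i)
    {D m r B : ℝ} (hD : 0 < D) (hdD : ∑ i ∈ J, d i ≤ D) (hm : 1 ≤ m) (hμ : μ.real Set.univ ≤ m)
    (hr : 2 ≤ r) (hB : 0 ≤ B)
    (hψB : ∀ i, eLpNorm (ψ i) (ENNReal.ofReal r) μ ≤ ENNReal.ofReal B) :
    eLpNorm (fun x => √(∑ i ∈ J, d i * ψ i x ^ 2 + D)) (ENNReal.ofReal r) μ ≤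
      ENNReal.ofReal √(D * (B ^ 2 + m)) := by
  have hr2 : 1 ≤ r / 2 := by linarith
  have hsq : ∀ f : X → ℝ, eLpNorm (fun x => f x ^ 2) (ENNReal.ofReal (r / 2)) μ =
      eLpNorm f (ENNReal.ofReal r) μ ^ (2 : ℝ) := by
    intro f
    have := eLpNorm_norm_rpow (p := ENNReal.ofReal (r / 2)) (μ := μ) f (q := 2) (by norm_num)
    rw [← ENNReal.ofReal_mul (by linarith), div_mul_cancel₀ _ two_ne_zero] at this
    rw [← this]
    simp
  rw [← ENNReal.rpow_le_rpow_iff (z := 2) (by norm_num), ← hsq,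
    ENNReal.ofReal_rpow_of_nonneg (Real.sqrt_nonneg _) (by norm_num), Real.rpow_two,
    Real.sq_sqrt (by positivity)]
  have hfun : (fun x => √(∑ i ∈ J, d i * ψ i x ^ 2 + D) ^ 2) =
      (∑ i ∈ J, d i • fun x => ψ i x ^ 2) + fun _ => D := by
    funext x
    rw [Real.sq_sqrt]
    · simp [Finset.sum_apply]
    · have : 0 ≤ ∑ i ∈ J, d i * ψ i x ^ 2 :=
        Finset.sum_nonneg fun i _ => mul_nonneg (hd i) (sq_nonneg _)
      linarith
  have hmeas : ∀ i ∈ J, AEStronglyMeasurable (d i • fun x => ψ i x ^ 2) μ := fun i _ =>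
    (((hψ i).pow_const 2).const_smul (d i)).aestronglyMeasurable
  have h1 : (1 : ℝ≥0∞) ≤ ENNReal.ofReal (r / 2) := by simpa using hr2
  rw [hfun]
  refine (eLpNorm_add_le (Finset.aestronglyMeasurable_sum _ hmeas)
    aestronglyMeasurable_const h1).trans ?_
  have hs1 : eLpNorm (∑ i ∈ J, d i • fun x => ψ i x ^ 2) (ENNReal.ofReal (r / 2)) μ ≤
      ENNReal.ofReal (D * B ^ 2) := by
    refine (eLpNorm_sum_le hmeas h1).trans ?_
    calc ∑ i ∈ J, eLpNorm (d i • fun x => ψ i x ^ 2) (ENNReal.ofReal (r / 2)) μ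
        ≤ ∑ i ∈ J, ENNReal.ofReal (d i * B ^ 2) := by
          refine Finset.sum_le_sum fun i _ => ?_
          rw [eLpNorm_const_smul, hsq, Real.enorm_eq_ofReal (hd i), ENNReal.ofReal_mul (hd i)]
          gcongr
          refine (ENNReal.rpow_le_rpow (hψB i) (by norm_num)).trans_eq ?_
          rw [ENNReal.ofReal_rpow_of_nonneg hB (by norm_num), Real.rpow_two]
      _ = ENNReal.ofReal ((∑ i ∈ J, d i) * B ^ 2) := by
          rw [Finset.sum_mul, ENNReal.ofReal_sum_of_nonneg]
          exact fun i _ => mul_nonneg (hd i) (sq_nonneg _)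
      _ ≤ _ := by gcongr
  have hs2 : eLpNorm (fun _ : X => D) (ENNReal.ofReal (r / 2)) μ ≤ ENNReal.ofReal (D * m) := by
    refine (eLpNorm_le_of_ae_bound (C := D) (Eventually.of_forall fun _ => ?_)).trans ?_
    · rw [Real.norm_of_nonneg hD.le]
    · rw [mul_comm D, ENNReal.ofReal_mul (by linarith), ENNReal.toReal_ofReal (by linarith)]
      gcongr
      rw [← ofReal_measureReal, ENNReal.ofReal_rpow_of_nonneg measureReal_nonneg (by positivity)]
      refine ENNReal.ofReal_le_ofReal ((Real.rpow_le_rpow measureReal_nonneg hμ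
        (by positivity)).trans ?_)
      exact (Real.rpow_le_rpow_of_exponent_le hm (inv_le_one_of_one_le₀ hr2)).trans_eq
        (Real.rpow_one _)
  refine (add_le_add hs1 hs2).trans_eq ?_
  rw [← ENNReal.ofReal_add (by positivity) (by positivity)]
  ring_nf

/-- The finite sums of the flow. -/
noncomputable def flowSum (ψ : ModeIdx → S3 → ℝ) (J : Finset ModeIdx) (v₀ v₁ : ModeIdx → ℝ) (T : ℝ) (x : S3) :
    ℝ :=
  ∑ i ∈ J, (Real.cos (i.1 * T) * v₀ i + Real.sin (i.1 * T) / i.1 * v₁ i) * ψ i x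

theorem measurable_flowSum {Ω : Type*} [MeasurableSpace Ω] {ψ : ModeIdx → S3 → ℝ}
    (hψ : ∀ i, Measurable (ψ i)) (J : Finset ModeIdx) {v₀ v₁ : ModeIdx → Ω → ℝ}
    (h₀ : ∀ i, Measurable (v₀ i)) (h₁ : ∀ i, Measurable (v₁ i)) :
    Measurable fun z : Ω × ℝ × S3 =>
      flowSum ψ J (fun i => v₀ i z.1) (fun i => v₁ i z.1) z.2.1 z.2.2 := by
  unfold flowSum
  refine Finset.measurable_sum _ fun i _ => ?_
  have := h₀ i
  have := h₁ i
  have := hψ i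
  fun_prop

theorem measurable_uncurry_flowSum {ψ : ModeIdx → S3 → ℝ} (hψ : ∀ i, Measurable (ψ i))
    (J : Finset ModeIdx) (v₀ v₁ : ModeIdx → ℝ) :
    Measurable (Function.uncurry (flowSum ψ J v₀ v₁)) := by
  unfold flowSum Function.uncurry
  refine Finset.measurable_sum _ fun i _ => ?_
  have := hψ i
  fun_prop

/-- The weight of the mode `i` in the variance of the flow. -/
noncomputable def modeVar (u₀ u₁ : ModeIdx → ℝ) (i : ModeIdx) : ℝ := u₀ i ^ 2 + (u₁ i / i.1) ^ 2

theorem modeVar_nonneg (u₀ u₁ : ModeIdx → ℝ) (i : ModeIdx) : 0 ≤ modeVar u₀ u₁ i := by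
  unfold modeVar; positivity

/-- The families `a` and `b` are treated as one independent family over the disjoint union of
indices, and $\cos^2,\sin^2\le1$ removes $T$. The terms `c + 1` and `D` keep the bound strictly
positive. -/
theorem eLpNorm_flowSum_le {Ω : Type*} [MeasurableSpace Ω] {P : Measure Ω} {a b : ModeIdx → Ω → ℝ}
    (hind : iIndepFun (fun j : ModeIdx ⊕ ModeIdx => Sum.elim a b j) P) {c : NNReal}
    (ha : ∀ i, HasSubgaussianMGF (a i) c P) (hb : ∀ i, HasSubgaussianMGF (b i) c P)
    (u₀ u₁ : ModeIdx → ℝ) (ψ : ModeIdx → S3 → ℝ) (J : Finset ModeIdx) {D : ℝ} (hD : 0 < D) {q : ℝ}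
    (hq : 1 ≤ q) (T : ℝ) (x : S3) :
    eLpNorm (fun ω => flowSum ψ J (fun i => u₀ i * a i ω) (fun i => u₁ i * b i ω) T x)
        (ENNReal.ofReal q) P ≤
      ENNReal.ofReal (2 * √q * (√(c + 1) * √(∑ i ∈ J, modeVar u₀ u₁ i * ψ i x ^ 2 + D))) := by
  let w : ModeIdx ⊕ ModeIdx → ℝ := Sum.elim (fun i => Real.cos (i.1 * T) * u₀ i * ψ i x)
    (fun i => Real.sin (i.1 * T) / i.1 * u₁ i * ψ i x)
  have hX : ∀ j, HasSubgaussianMGF (Sum.elim a b j) c P := by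
    rintro (i | i)
    exacts [ha i, hb i]
  have hs := hasSubgaussianMGF_sum_mul hind hX (J.disjSum J) w
  have hfun : (fun ω => ∑ j ∈ J.disjSum J, w j * Sum.elim a b j ω) =
      fun ω => flowSum ψ J (fun i => u₀ i * a i ω) (fun i => u₁ i * b i ω) T x := by
    funext ω
    rw [Finset.sum_disjSum, flowSum, ← Finset.sum_add_distrib]
    refine Finset.sum_congr rfl fun i _ => ?_
    simp only [w, Sum.elim_inl, Sum.elim_inr]
    ring
  rw [hfun] at hs
  have hsum : 0 ≤ ∑ i ∈ J, modeVar u₀ u₁ i * ψ i x ^ 2 :=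
    Finset.sum_nonneg fun i _ => mul_nonneg (modeVar_nonneg _ _ _) (sq_nonneg _)
  refine hs.eLpNorm_le hq (by positivity) ?_
  rw [mul_pow, Real.sq_sqrt (by positivity), Real.sq_sqrt (by positivity)]
  rw [NNReal.coe_sum]
  change ∑ j ∈ J.disjSum J, w j ^ 2 * (c : ℝ) ≤ _
  rw [← Finset.sum_mul, mul_comm]
  have hw : ∑ j ∈ J.disjSum J, w j ^ 2 ≤ ∑ i ∈ J, modeVar u₀ u₁ i * ψ i x ^ 2 := by
    rw [Finset.sum_disjSum, ← Finset.sum_add_distrib]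
    refine Finset.sum_le_sum fun i _ => ?_
    simp only [w, Sum.elim_inl, Sum.elim_inr, modeVar]
    have h1 := Real.cos_sq_le_one (i.1 * T)
    have h2 := Real.sin_sq_le_one (i.1 * T)
    calc (Real.cos (i.1 * T) * u₀ i * ψ i x) ^ 2 +
          (Real.sin (i.1 * T) / i.1 * u₁ i * ψ i x) ^ 2
        = (Real.cos (i.1 * T) ^ 2 * u₀ i ^ 2 + Real.sin (i.1 * T) ^ 2 * (u₁ i / i.1) ^ 2) *
            ψ i x ^ 2 := by ring
      _ ≤ (1 * u₀ i ^ 2 + 1 * (u₁ i / i.1) ^ 2) * ψ i x ^ 2 := by gcongr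
      _ = _ := by ring
  gcongr
  · linarith
  · linarith

/-- A bound for the volume of the sphere. -/
noncomputable def volBound : ℝ := max 1 (surf.real Set.univ)

theorem one_le_volBound : 1 ≤ volBound := le_max_left _ _

theorem surf_univ_rpow_le {t : ℝ} (h0 : 0 ≤ t) (h1 : t ≤ 1) :
    surf Set.univ ^ t ≤ ENNReal.ofReal volBound := by
  rw [← ofReal_measureReal, ENNReal.ofReal_rpow_of_nonneg measureReal_nonneg h0]
  refine ENNReal.ofReal_le_ofReal ((Real.rpow_le_rpow measureReal_nonneg (le_max_right 1 _)
    h0).trans ?_)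
  exact (Real.rpow_le_rpow_of_exponent_le one_le_volBound h1).trans_eq (Real.rpow_one _)

/-- The moments of the mixed norm of a finite random sum. -/
theorem eLpNorm_mixedNorm_flowSum_le {Ω : Type*} [MeasurableSpace Ω] {P : Measure Ω}
    [IsProbabilityMeasure P] {a b : ModeIdx → Ω → ℝ}
    (ham : ∀ i, Measurable (a i)) (hbm : ∀ i, Measurable (b i))
    (hind : iIndepFun (fun j : ModeIdx ⊕ ModeIdx => Sum.elim a b j) P) {c : NNReal}
    (ha : ∀ i, HasSubgaussianMGF (a i) c P) (hb : ∀ i, HasSubgaussianMGF (b i) c P)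
    (u₀ u₁ : ModeIdx → ℝ) {ψ : ModeIdx → S3 → ℝ} (hψ : ∀ i, Measurable (ψ i))
    (J : Finset ModeIdx) {D : ℝ} (hD : 0 < D) (hdD : ∑ i ∈ J, modeVar u₀ u₁ i ≤ D)
    {s r q B : ℝ} (hs : 1 ≤ s) (hsr : s ≤ r) (hrq : r ≤ q) (hB : 0 ≤ B)
    (hψB : ∀ i, eLpNorm (ψ i) (ENNReal.ofReal (max r 2)) surf ≤ ENNReal.ofReal B) :
    eLpNorm (fun ω => mixedNorm s r
        (flowSum ψ J (fun i => u₀ i * a i ω) (fun i => u₁ i * b i ω))) (ENNReal.ofReal q) P ≤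
      ENNReal.ofReal (2 * √(c + 1) * Real.pi * volBound * √(B ^ 2 + volBound) * √q * √D) := by
  have hr : 1 ≤ r := hs.trans hsr
  have hs0 : 0 < s := by linarith
  have hr0 : 0 < r := by linarith
  have hq : 1 ≤ q := hr.trans hrq
  have hm := one_le_volBound
  set f : Ω → ℝ × S3 → ℝ := fun ω z =>
    flowSum ψ J (fun i => u₀ i * a i ω) (fun i => u₁ i * b i ω) z.1 z.2 with hf
  have hfm : Measurable (Function.uncurry f) := measurable_flowSum hψ J
    (v₀ := fun i ω => u₀ i * a i ω) (v₁ := fun i ω => u₁ i * b i ω)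
    (fun i => (ham i).const_mul _) (fun i => (hbm i).const_mul _)
  set h : S3 → ℝ := fun x => √(∑ i ∈ J, modeVar u₀ u₁ i * ψ i x ^ 2 + D) with hh
  have hhm : Measurable h := by
    refine Measurable.sqrt (Measurable.add_const (Finset.measurable_sum _ fun i _ => ?_) _)
    exact ((hψ i).pow_const 2).const_mul _
  have hsum : ∀ x, 0 ≤ ∑ i ∈ J, modeVar u₀ u₁ i * ψ i x ^ 2 := fun x =>
    Finset.sum_nonneg fun i _ => mul_nonneg (modeVar_nonneg _ _ _) (sq_nonneg _)
  have hh0 : ∀ x, 0 < h x := fun x => Real.sqrt_pos.2 (by linarith [hsum x])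
  set k : ℝ := 2 * √q * √(c + 1) with hk
  have hk0 : 0 < k := by positivity
  have hmain := eLpNorm_eLpNorm_le (P := P) (μ := cauchyWeight.prod surf) hfm
    (H := fun z => ENNReal.ofReal (k * h z.2)) (by fun_prop)
    (fun z => by simpa using mul_pos hk0 (hh0 z.2)) (fun z => ENNReal.ofReal_ne_top) hr0 hrq
    (fun z => by
      simpa only [hk, mul_assoc] using eLpNorm_flowSum_le hind ha hb u₀ u₁ ψ J hD hq z.1 z.2)
  have hH : eLpNorm (fun z : ℝ × S3 => ENNReal.ofReal (k * h z.2)) (ENNReal.ofReal r)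
      (cauchyWeight.prod surf) ≤ cauchyWeight Set.univ ^ (1 / r) *
        (ENNReal.ofReal k * (ENNReal.ofReal volBound *
          ENNReal.ofReal √(D * (B ^ 2 + volBound)))) := by
    have h1 : eLpNorm (fun z : ℝ × S3 => ENNReal.ofReal (k * h z.2)) (ENNReal.ofReal r)
        (cauchyWeight.prod surf) = eLpNorm (Function.uncurry fun (_ : ℝ) (x : S3) => k * h x)
          (ENNReal.ofReal r) (cauchyWeight.prod surf) := by
      rw [← eLpNorm_enorm (Function.uncurry fun (_ : ℝ) (x : S3) => k * h x)]
      congr 1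
      funext z
      exact (Real.enorm_eq_ofReal (mul_pos hk0 (hh0 z.2)).le).symm
    rw [h1, eLpNorm_prod_eq (by simp only [Function.uncurry_def]; fun_prop) hr0,
      eLpNorm_ofReal_eq _ hr0]
    simp only [lintegral_const, enorm_eq_self]
    rw [ENNReal.mul_rpow_of_nonneg _ _ (by positivity), ← ENNReal.rpow_mul,
      mul_one_div_cancel hr0.ne', ENNReal.rpow_one, mul_comm]
    gcongr
    have h2 : eLpNorm (fun x => k * h x) (ENNReal.ofReal r) surf =
        ENNReal.ofReal k * eLpNorm h (ENNReal.ofReal r) surf := by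
      rw [← Real.enorm_eq_ofReal hk0.le]
      exact eLpNorm_const_smul k h _ _
    rw [h2]
    gcongr
    -- `eLpNorm_sqrt_sum_le` needs an exponent at least 2, whereas $r$ may lie in $[1,2)$.
    refine (eLpNorm_le_eLpNorm_mul_rpow_measure_univ (ENNReal.ofReal_le_ofReal (le_max_left r 2))
      hhm.aestronglyMeasurable).trans ?_
    rw [mul_comm, ENNReal.toReal_ofReal hr0.le, ENNReal.toReal_ofReal (by positivity)]
    gcongr
    · refine surf_univ_rpow_le ?_ ?_
      · rw [sub_nonneg]
        exact one_div_le_one_div_of_le hr0 (le_max_left _ _)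
      · have : 1 / r ≤ 1 := (div_le_one hr0).2 hr
        have : 0 ≤ 1 / max r 2 := by positivity
        linarith
    · exact eLpNorm_sqrt_sum_le hψ J (modeVar_nonneg u₀ u₁) hD hdD hm (le_max_right _ _)
        (le_max_right _ _) hB hψB
  -- Hölder in $T$ on a measure of mass $\pi$ raises $s$ to $r$, making the norm an $L^r$ norm on
  -- the product. The powers of $\pi$ finally combine to $\pi^{1/s}\le\pi$.
  have hpt : ∀ ω, mixedNorm s r (flowSum ψ J (fun i => u₀ i * a i ω) (fun i => u₁ i * b i ω)) ≤
      cauchyWeight Set.univ ^ (1 / s - 1 / r) *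
        eLpNorm (f ω) (ENNReal.ofReal r) (cauchyWeight.prod surf) := by
    intro ω
    have hfω : Measurable (f ω) := hfm.of_uncurry_left
    have := eLpNorm_prod_eq (μ := cauchyWeight) (ν := surf) (f := flowSum ψ J
      (fun i => u₀ i * a i ω) (fun i => u₁ i * b i ω)) hfω hr0
    rw [show f ω = Function.uncurry (flowSum ψ J (fun i => u₀ i * a i ω)
      (fun i => u₁ i * b i ω)) from rfl, this, mul_comm]
    have h3 := eLpNorm_le_eLpNorm_mul_rpow_measure_univ (μ := cauchyWeight)
      (ENNReal.ofReal_le_ofReal hsr) (measurable_eLpNorm_right (μ := surf) (f := flowSum ψ J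
      (fun i => u₀ i * a i ω) (fun i => u₁ i * b i ω)) hfω hr0).aestronglyMeasurable
    rwa [ENNReal.toReal_ofReal hs0.le, ENNReal.toReal_ofReal hr0.le] at h3
  set G := fun ω => eLpNorm (f ω) (ENNReal.ofReal r) (cauchyWeight.prod surf) with hG
  have hq0 : 0 < q := by linarith
  have hexp : 0 ≤ 1 / s - 1 / r := by
    rw [sub_nonneg]; exact one_div_le_one_div_of_le hs0 hsr
  have hcw : ∀ t : ℝ, 0 ≤ t → cauchyWeight Set.univ ^ t ≠ ∞ := fun t ht =>
    ENNReal.rpow_ne_top_of_nonneg ht (measure_ne_top _ _)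
  calc eLpNorm (fun ω => mixedNorm s r
        (flowSum ψ J (fun i => u₀ i * a i ω) (fun i => u₁ i * b i ω))) (ENNReal.ofReal q) P
      ≤ eLpNorm (fun ω => cauchyWeight Set.univ ^ (1 / s - 1 / r) * G ω)
          (ENNReal.ofReal q) P := eLpNorm_mono_enorm hpt
    _ = cauchyWeight Set.univ ^ (1 / s - 1 / r) * eLpNorm G (ENNReal.ofReal q) P := by
        rw [eLpNorm_ofReal_eq _ hq0, eLpNorm_ofReal_eq _ hq0]
        simp only [enorm_eq_self, ENNReal.mul_rpow_of_nonneg _ _ hq0.le]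
        rw [lintegral_const_mul' _ _ (ENNReal.rpow_ne_top_of_nonneg hq0.le (hcw _ hexp)),
          ENNReal.mul_rpow_of_nonneg _ _ (by positivity), ← ENNReal.rpow_mul,
          mul_one_div_cancel hq0.ne', ENNReal.rpow_one]
    _ ≤ cauchyWeight Set.univ ^ (1 / s - 1 / r) * (cauchyWeight Set.univ ^ (1 / r) *
          (ENNReal.ofReal k * (ENNReal.ofReal volBound *
            ENNReal.ofReal √(D * (B ^ 2 + volBound))))) := by
        gcongr
        exact hmain.trans hH
    _ = cauchyWeight Set.univ ^ (1 / s) * (ENNReal.ofReal k * (ENNReal.ofReal volBound *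
            ENNReal.ofReal √(D * (B ^ 2 + volBound)))) := by
        rw [← mul_assoc, ← ENNReal.rpow_add_of_nonneg _ _ hexp (by positivity), sub_add_cancel]
    _ ≤ ENNReal.ofReal Real.pi * (ENNReal.ofReal k * (ENNReal.ofReal volBound *
            ENNReal.ofReal √(D * (B ^ 2 + volBound)))) := by
        gcongr
        rw [cauchyWeight_univ, ENNReal.ofReal_rpow_of_nonneg Real.pi_pos.le (by positivity)]
        refine ENNReal.ofReal_le_ofReal ((Real.rpow_le_rpow_of_exponent_le
          (by linarith [Real.pi_gt_three]) ((div_le_one hs0).2 hs)).trans_eq (Real.rpow_one _))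
    _ = _ := by
        have := Real.pi_pos
        rw [← ENNReal.ofReal_mul (by positivity), ← ENNReal.ofReal_mul (by positivity),
          ← ENNReal.ofReal_mul (by positivity), Real.sqrt_mul hD.le, hk]
        congr 1
        ring

/-! ### The flow in `L²` and its truncations -/

/-- The modes with `N < n ≤ L`. -/
noncomputable def modes (N L : ℕ) : Finset ModeIdx := (finite_low L).toFinset.filter fun i => N < i.1

theorem mem_modes {N L : ℕ} {i : ModeIdx} : i ∈ modes N L ↔ N < i.1 ∧ i.1 ≤ L := by
  simp [modes, and_comm]

theorem ModeIdx.one_le (i : ModeIdx) : 1 ≤ i.1 := by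
  obtain ⟨n, k⟩ := i
  rcases Nat.eq_zero_or_pos n with rfl | h
  · exact absurd k.2 (by simp)
  · exact h

theorem ModeIdx.one_le_cast (i : ModeIdx) : (1 : ℝ) ≤ i.1 := by exact_mod_cast i.one_le

/-- The coefficients of the flow. -/
noncomputable def flowCoeff (v₀ v₁ : ModeIdx → ℝ) (T : ℝ) (i : ModeIdx) : ℝ :=
  Real.cos (i.1 * T) * v₀ i + Real.sin (i.1 * T) / i.1 * v₁ i

/-- The terms of the series defining `tailSum`. -/
noncomputable def modeWeight (σ : ℝ) (u₀ u₁ : ModeIdx → ℝ) (i : ModeIdx) : ℝ :=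
  (i.1 : ℝ) ^ (2 * σ) * u₀ i ^ 2 + (i.1 : ℝ) ^ (2 * (σ - 1)) * u₁ i ^ 2

theorem modeWeight_nonneg (σ : ℝ) (u₀ u₁ : ModeIdx → ℝ) (i : ModeIdx) :
    0 ≤ modeWeight σ u₀ u₁ i := by unfold modeWeight; positivity

/-- The factor $n^{2\sigma}\ge1$ is discarded in claims 1 and 2; in claim 3 with $\sigma>0$ it pays
for the sum over dyadic blocks. -/
theorem modeWeight_eq (σ : ℝ) (u₀ u₁ : ModeIdx → ℝ) (i : ModeIdx) :
    modeWeight σ u₀ u₁ i = (i.1 : ℝ) ^ (2 * σ) * modeVar u₀ u₁ i := by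
  have hi : (0 : ℝ) < i.1 := by linarith [i.one_le_cast]
  rw [modeWeight, modeVar, mul_sub, Real.rpow_sub hi, mul_one, Real.rpow_two]
  ring

theorem modeVar_le {σ : ℝ} (hσ : 0 ≤ σ) (u₀ u₁ : ModeIdx → ℝ) (i : ModeIdx) :
    modeVar u₀ u₁ i ≤ modeWeight σ u₀ u₁ i := by
  rw [modeWeight_eq]
  exact le_mul_of_one_le_left (modeVar_nonneg _ _ _)
    (Real.one_le_rpow i.one_le_cast (by linarith))

theorem summable_modeWeight {σ : ℝ} {u₀ u₁ : ModeIdx → ℝ} (h₀ : MemSobolev σ u₀)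
    (h₁ : MemSobolev (σ - 1) u₁) : Summable (modeWeight σ u₀ u₁) := h₀.add h₁

theorem tailSum_eq (σ : ℝ) (u₀ u₁ : ModeIdx → ℝ) (N : ℕ) :
    tailSum σ u₀ u₁ N = ∑' i : ModeIdx, if N < i.1 then modeWeight σ u₀ u₁ i else 0 := rfl

theorem sum_modeWeight_le_tailSum {σ : ℝ} {u₀ u₁ : ModeIdx → ℝ} (h₀ : MemSobolev σ u₀)
    (h₁ : MemSobolev (σ - 1) u₁) {N : ℕ} (J : Finset ModeIdx) (hJ : ∀ i ∈ J, N < i.1) :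
    ∑ i ∈ J, modeWeight σ u₀ u₁ i ≤ tailSum σ u₀ u₁ N := by
  have hs : Summable fun i : ModeIdx => if N < i.1 then modeWeight σ u₀ u₁ i else 0 := by
    refine (summable_modeWeight h₀ h₁).of_nonneg_of_le (fun i => ?_) fun i => ?_
    · split_ifs <;> simp [modeWeight_nonneg]
    · split_ifs <;> simp [modeWeight_nonneg]
  rw [tailSum_eq]
  refine le_trans (Finset.sum_le_sum fun i hi => ?_) (hs.sum_le_tsum J fun i _ => ?_)
  · rw [if_pos (hJ i hi)]
  · split_ifs <;> simp [modeWeight_nonneg]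

theorem tailSum_nonneg (σ : ℝ) (u₀ u₁ : ModeIdx → ℝ) (N : ℕ) : 0 ≤ tailSum σ u₀ u₁ N :=
  tsum_nonneg fun i => by
    split_ifs
    exacts [modeWeight_nonneg σ u₀ u₁ i, le_rfl]

theorem tailSum_zero_pos {σ : ℝ} {u₀ u₁ : ModeIdx → ℝ} (h₀ : MemSobolev σ u₀)
    (h₁ : MemSobolev (σ - 1) u₁) (h : ∃ i, u₀ i ≠ 0 ∨ u₁ i ≠ 0) : 0 < tailSum σ u₀ u₁ 0 := by
  obtain ⟨i, hi⟩ := h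
  have hi0 : (0 : ℝ) < i.1 := by linarith [i.one_le_cast]
  have h1 := sum_modeWeight_le_tailSum h₀ h₁ {i} (N := 0) fun j hj => by
    rw [Finset.mem_singleton.1 hj]; exact i.one_le
  rw [Finset.sum_singleton] at h1
  refine lt_of_lt_of_le ?_ h1
  have hp1 := Real.rpow_pos_of_pos hi0 (2 * σ)
  have hp2 := Real.rpow_pos_of_pos hi0 (2 * (σ - 1))
  unfold modeWeight
  rcases hi with hi | hi
  · have : 0 < u₀ i ^ 2 := by positivity
    positivity
  · have : 0 < u₁ i ^ 2 := by positivity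
    positivity

theorem summable_flowCoeff_sq {σ : ℝ} (hσ : 0 ≤ σ) {v₀ v₁ : ModeIdx → ℝ} (h₀ : MemSobolev σ v₀)
    (h₁ : MemSobolev (σ - 1) v₁) (T : ℝ) : Summable fun i => flowCoeff v₀ v₁ T i ^ 2 := by
  refine ((summable_modeWeight h₀ h₁).mul_left 2).of_nonneg_of_le (fun i => sq_nonneg _) fun i => ?_
  refine le_trans ?_ (mul_le_mul_of_nonneg_left (modeVar_le hσ v₀ v₁ i) zero_le_two)
  have h1 := Real.cos_sq_le_one (i.1 * T)
  have h2 := Real.sin_sq_le_one (i.1 * T)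
  unfold flowCoeff modeVar
  calc (Real.cos (i.1 * T) * v₀ i + Real.sin (i.1 * T) / i.1 * v₁ i) ^ 2
      ≤ 2 * (Real.cos (i.1 * T) ^ 2 * v₀ i ^ 2 + Real.sin (i.1 * T) ^ 2 * (v₁ i / i.1) ^ 2) := by
        refine (add_sq_le).trans_eq ?_
        ring
    _ ≤ 2 * (1 * v₀ i ^ 2 + 1 * (v₁ i / i.1) ^ 2) := by gcongr
    _ = _ := by ring

theorem hasSum_linFlow (e : HilbertBasis ModeIdx ℝ L2S3) {v₀ v₁ : ModeIdx → ℝ} {T : ℝ}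
    (h : Summable fun i => flowCoeff v₀ v₁ T i ^ 2) :
    HasSum (fun i => flowCoeff v₀ v₁ T i • e i) (linFlow e v₀ v₁ T) := by
  have hm : Memℓp (flowCoeff v₀ v₁ T) 2 := by
    refine memℓp_gen ?_
    simpa using h
  exact (e.hasSum_repr_symm ⟨flowCoeff v₀ v₁ T, hm⟩).summable.hasSum

theorem lowProj_of_hasSum (e : HilbertBasis ModeIdx ℝ L2S3) {c : ModeIdx → ℝ} {v : L2S3}
    (h : HasSum (fun i => c i • e i) v) (N : ℕ) :
    lowProj e N v = ∑ i ∈ modes 0 N, c i • e i := by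
  classical
  have hin : ∀ j, inner ℝ (e j) v = c j := by
    intro j
    have h1 := h.mapL (innerSL ℝ (e j))
    have h2 : HasSum (fun i => innerSL ℝ (e j) (c i • e i)) (c j) := by
      convert hasSum_single j fun i hi => ?_ using 1
      · simp [e.orthonormal.1 j]
      · simp [e.orthonormal.2 hi.symm]
    exact h1.unique h2
  refine (Submodule.eq_starProjection_of_mem_of_inner_eq_zero ?_ ?_)
  · refine Submodule.sum_mem _ fun i hi => Submodule.smul_mem _ _ (Submodule.subset_span ?_)
    exact ⟨i, (mem_modes.1 hi).2, rfl⟩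
  · intro w hw
    induction hw using Submodule.span_induction with
    | mem x hx =>
      obtain ⟨j, hj, rfl⟩ := hx
      have hjm : j ∈ modes 0 N := mem_modes.2 ⟨j.one_le, hj⟩
      rw [real_inner_comm, inner_sub_right, hin, e.orthonormal.inner_right_sum _ hjm, sub_self]
    | zero => exact inner_zero_right _
    | add x y _ _ hx hy => rw [inner_add_right, hx, hy, add_zero]
    | smul a x _ hx => rw [inner_smul_right, hx, mul_zero]

theorem tendsto_modes_zero : Tendsto (modes 0) atTop atTop := by
  refine tendsto_atTop_finset_of_monotone (fun L L' h i hi => ?_) fun i => ⟨i.1, ?_⟩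
  · have := mem_modes.1 hi
    exact mem_modes.2 ⟨this.1, this.2.trans h⟩
  · exact mem_modes.2 ⟨i.one_le, le_rfl⟩

theorem tendsto_sum_modes (e : HilbertBasis ModeIdx ℝ L2S3) {c : ModeIdx → ℝ} {v : L2S3}
    (h : HasSum (fun i => c i • e i) v) (N : ℕ) :
    Tendsto (fun L => ∑ i ∈ modes N L, c i • e i) atTop (𝓝 (v - lowProj e N v)) := by
  have h1 : Tendsto (fun L => ∑ i ∈ modes 0 L, c i • e i) atTop (𝓝 v) := h.comp tendsto_modes_zero
  rw [lowProj_of_hasSum e h]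
  refine (h1.sub_const _).congr' ?_
  filter_upwards [eventually_ge_atTop N] with L hL
  rw [sub_eq_iff_eq_add]
  have : modes 0 L = modes N L ∪ modes 0 N := by
    ext i
    simp only [Finset.mem_union, mem_modes]
    omega
  rw [this, Finset.sum_union]
  exact Finset.disjoint_left.2 fun i hi hi' => by
    rw [mem_modes] at hi hi'
    omega

theorem coeFn_sum_smul {e : ModeIdx → L2S3} {ψ : ModeIdx → S3 → ℝ}
    (he : ∀ i, (e i : S3 → ℝ) =ᵐ[surf] ψ i) (c : ModeIdx → ℝ) (J : Finset ModeIdx) :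
    ((∑ i ∈ J, c i • e i : L2S3) : S3 → ℝ) =ᵐ[surf] fun x => ∑ i ∈ J, c i * ψ i x := by
  classical
  induction J using Finset.induction_on with
  | empty =>
    simp only [Finset.sum_empty]
    exact Lp.coeFn_zero ℝ 2 surf
  | insert i J hi ih =>
    rw [Finset.sum_insert hi]
    filter_upwards [Lp.coeFn_add (c i • e i) (∑ i ∈ J, c i • e i), Lp.coeFn_smul (c i) (e i), ih,
      he i] with x h1 h2 h3 h4
    rw [h1, Pi.add_apply, h2, h3, Finset.sum_insert hi, Pi.smul_apply, h4, smul_eq_mul]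

/-- Lower semicontinuity of the $L^r$ norm at each $T$, followed by Fatou in $T$. The right side
involves only finite sums, which are jointly measurable. -/
theorem weightedNorm_le_liminf {e : HilbertBasis ModeIdx ℝ L2S3} {ψ : ModeIdx → S3 → ℝ}
    (hψ : ∀ i, Measurable (ψ i)) (he : ∀ i, (e i : S3 → ℝ) =ᵐ[surf] ψ i) {s r : ℝ} (hs : 1 ≤ s)
    (hr : 0 < r) {v₀ v₁ : ModeIdx → ℝ} {N : ℕ} {F : ℝ → L2S3}
    (hF : ∀ T, Tendsto (fun L => ∑ i ∈ modes N L, flowCoeff v₀ v₁ T i • e i) atTop (𝓝 (F T))) :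
    weightedNorm (2 / s) (ENNReal.ofReal s) (ENNReal.ofReal r) F ≤
      liminf (fun L => mixedNorm s r (flowSum ψ (modes N L) v₀ v₁)) atTop := by
  have hm : ∀ L, Measurable fun T =>
      eLpNorm (flowSum ψ (modes N L) v₀ v₁ T) (ENNReal.ofReal r) surf := fun L =>
    measurable_eLpNorm_right (measurable_uncurry_flowSum hψ _ _ _) hr
  refine (weightedNorm_le hs _ (Measurable.liminf hm) fun T => ?_).trans
    (eLpNorm_liminf_le hm (by linarith))
  refine (eLpNorm_le_liminf_of_tendsto_Lp (hF T) _).trans_eq ?_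
  congr 1
  funext L
  exact eLpNorm_congr_ae (coeFn_sum_smul he _ _)

theorem measurable_mixedNorm_flowSum {Ω : Type*} [MeasurableSpace Ω] {ψ : ModeIdx → S3 → ℝ}
    (hψ : ∀ i, Measurable (ψ i)) (J : Finset ModeIdx) {v₀ v₁ : ModeIdx → Ω → ℝ}
    (h₀ : ∀ i, Measurable (v₀ i)) (h₁ : ∀ i, Measurable (v₁ i)) {s r : ℝ} (hs : 0 < s)
    (hr : 0 < r) :
    Measurable fun ω => mixedNorm s r (flowSum ψ J (fun i => v₀ i ω) (fun i => v₁ i ω)) := by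
  refine measurable_eLpNorm_right_ennreal (f := fun ω T =>
    eLpNorm (flowSum ψ J (fun i => v₀ i ω) (fun i => v₁ i ω) T) (ENNReal.ofReal r) surf) ?_ hs
  refine measurable_eLpNorm_right (Ω := Ω × ℝ) (f := fun z x =>
    flowSum ψ J (fun i => v₀ i z.1) (fun i => v₁ i z.1) z.2 x) ?_ hr
  exact (measurable_flowSum hψ J h₀ h₁).comp (f := fun z : (Ω × ℝ) × S3 => (z.1.1, z.1.2, z.2))
    (by fun_prop)

/-! ### Almost sure regularity -/

/-- The second moments are uniformly bounded, so the expectation of the whole nonnegative series is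
finite. -/
theorem ae_summable_mul_sq {Ω ι : Type*} [Countable ι] [MeasurableSpace Ω] {P : Measure Ω}
    {X : ι → Ω → ℝ} (hXm : ∀ i, Measurable (X i)) {c : NNReal}
    (hX : ∀ i, HasSubgaussianMGF (X i) c P) {w : ι → ℝ} (hw : ∀ i, 0 ≤ w i) (hs : Summable w) :
    ∀ᵐ ω ∂P, Summable fun i => w i * X i ω ^ 2 := by
  set K := ENNReal.ofReal (2 * √2 * √(c + 1)) ^ (2 : ℝ) with hK
  have hKtop : K ≠ ∞ := ENNReal.rpow_ne_top_of_nonneg (by norm_num) ENNReal.ofReal_ne_top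
  have hint : ∀ i, ∫⁻ ω, ENNReal.ofReal (w i * X i ω ^ 2) ∂P ≤ ENNReal.ofReal (w i) * K := by
    intro i
    have h1 := (hX i).eLpNorm_le (q := 2) (v := √(c + 1)) (by norm_num) (by positivity)
      (by rw [Real.sq_sqrt (by positivity)]; linarith)
    have h2 := eLpNorm_ofReal_rpow (μ := P) (X i) (q := 2) (by norm_num)
    simp only [ENNReal.ofReal_mul (hw i)]
    rw [lintegral_const_mul' _ _ ENNReal.ofReal_ne_top]
    gcongr
    refine le_trans (le_of_eq ?_) (h2.symm.le.trans (ENNReal.rpow_le_rpow h1 (by norm_num)))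
    refine lintegral_congr fun ω => ?_
    rw [Real.enorm_eq_ofReal_abs, ENNReal.ofReal_rpow_of_nonneg (abs_nonneg _) (by norm_num),
      Real.rpow_two, sq_abs]
  have hfin : ∫⁻ ω, ∑' i, ENNReal.ofReal (w i * X i ω ^ 2) ∂P ≠ ∞ := by
    rw [lintegral_tsum fun i => by have := hXm i; fun_prop]
    refine ne_top_of_le_ne_top ?_ (ENNReal.tsum_le_tsum hint)
    rw [ENNReal.tsum_mul_right]
    exact ENNReal.mul_ne_top hs.tsum_ofReal_ne_top hKtop
  have hmeas : Measurable fun ω => ∑' i, ENNReal.ofReal (w i * X i ω ^ 2) :=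
    Measurable.tsum fun i => by have := hXm i; fun_prop
  filter_upwards [ae_lt_top hmeas hfin] with ω hω
  have := ENNReal.summable_toReal hω.ne
  refine this.congr fun i => ?_
  rw [ENNReal.toReal_ofReal (mul_nonneg (hw i) (sq_nonneg _))]

theorem ae_memSobolev_mul {Ω : Type*} [MeasurableSpace Ω] {P : Measure Ω}
    {X : ModeIdx → Ω → ℝ} (hXm : ∀ i, Measurable (X i)) {c : NNReal}
    (hX : ∀ i, HasSubgaussianMGF (X i) c P) {s : ℝ} {u : ModeIdx → ℝ} (hu : MemSobolev s u) :
    ∀ᵐ ω ∂P, MemSobolev s fun i => u i * X i ω := by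
  filter_upwards [ae_summable_mul_sq hXm hX (fun i => by positivity) hu] with ω hω
  refine hω.congr fun i => ?_
  ring

/-! ### The sup norm of the truncated flow -/

theorem eLpNorm_top_flowSum_le {ψ : ModeIdx → S3 → ℝ} {Q : ModeIdx → MvPolynomial (Fin 4) ℝ}
    (hψ : ∀ i, ψ i = polyS (Q i)) (hQ : ∀ i, (Q i).totalDegree ≤ i.1 - 1) {k : ℕ} {K : ℝ}
    (hK : ∀ (D : ℕ) (Q : MvPolynomial (Fin 4) ℝ), Q.totalDegree ≤ D →
      eLpNorm (polyS Q) ∞ surf ≤ ENNReal.ofReal (K * ((D : ℝ) + 1) ^ (2 / k : ℝ)) *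
        eLpNorm (polyS Q) (ENNReal.ofReal (2 * k)) surf)
    {J : Finset ModeIdx} {D : ℕ} (hJ : ∀ i ∈ J, i.1 ≤ D) (v₀ v₁ : ModeIdx → ℝ) (T : ℝ) :
    eLpNorm (flowSum ψ J v₀ v₁ T) ∞ surf ≤ ENNReal.ofReal (K * ((D : ℝ) + 1) ^ (2 / k : ℝ)) *
      eLpNorm (flowSum ψ J v₀ v₁ T) (ENNReal.ofReal (2 * k)) surf := by
  have h : flowSum ψ J v₀ v₁ T = polyS (∑ i ∈ J, flowCoeff v₀ v₁ T i • Q i) := by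
    funext x
    simp only [flowSum, hψ, map_sum, map_smul, ContinuousMap.sum_apply, ContinuousMap.smul_apply,
      smul_eq_mul, flowCoeff]
  rw [h]
  refine hK D _ ((MvPolynomial.totalDegree_finsetSum _ _).trans (Finset.sup_le fun i hi => ?_))
  have h1 := MvPolynomial.totalDegree_smul_le (flowCoeff v₀ v₁ T i) (Q i)
  have h2 := hQ i
  have h3 := hJ i hi
  omega

/-- The modes are grouped by `g` and the Nikolskii inequality is applied to each group with its own
degree bound, after the triangle inequality in $L^\infty_x$. -/
theorem weightedNorm_lowProj_le {e : HilbertBasis ModeIdx ℝ L2S3} {ψ : ModeIdx → S3 → ℝ}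
    (hψm : ∀ i, Measurable (ψ i)) (he : ∀ i, (e i : S3 → ℝ) =ᵐ[surf] ψ i)
    {Q : ModeIdx → MvPolynomial (Fin 4) ℝ}
    (hψ : ∀ i, ψ i = polyS (Q i)) (hQ : ∀ i, (Q i).totalDegree ≤ i.1 - 1) {k : ℕ} (hk : 1 ≤ k)
    {K : ℝ}
    (hK : ∀ (D : ℕ) (Q : MvPolynomial (Fin 4) ℝ), Q.totalDegree ≤ D →
      eLpNorm (polyS Q) ∞ surf ≤ ENNReal.ofReal (K * ((D : ℝ) + 1) ^ (2 / k : ℝ)) *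
        eLpNorm (polyS Q) (ENNReal.ofReal (2 * k)) surf)
    {M m : ℕ} {g : ModeIdx → ℕ} (hg : ∀ i ∈ modes 0 M, g i < m) {D : ℕ → ℕ}
    (hD : ∀ i ∈ modes 0 M, i.1 ≤ D (g i)) {v₀ v₁ : ModeIdx → ℝ}
    (hv : ∀ T, Summable fun i => flowCoeff v₀ v₁ T i ^ 2) :
    weightedNorm 2 1 ∞ (fun T => lowProj e M (linFlow e v₀ v₁ T)) ≤
      ∑ j ∈ Finset.range m, ENNReal.ofReal (K * ((D j : ℝ) + 1) ^ (2 / k : ℝ)) *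
        mixedNorm 1 (2 * k) (flowSum ψ ((modes 0 M).filter fun i => g i = j) v₀ v₁) := by
  have hk0 : (0 : ℝ) < 2 * k := by positivity
  set J : ℕ → Finset ModeIdx := fun j => (modes 0 M).filter fun i => g i = j with hJ
  set A : ℕ → ℝ≥0∞ := fun j => ENNReal.ofReal (K * ((D j : ℝ) + 1) ^ (2 / k : ℝ)) with hA
  have hfm : ∀ j, Measurable (Function.uncurry (flowSum ψ (J j) v₀ v₁)) := fun j =>
    measurable_uncurry_flowSum hψm _ _ _
  have hm : ∀ j, Measurable fun T =>
      eLpNorm (flowSum ψ (J j) v₀ v₁ T) (ENNReal.ofReal (2 * k)) surf := fun j =>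
    measurable_eLpNorm_right (hfm j) hk0
  have hpt : ∀ T, eLpNorm (lowProj e M (linFlow e v₀ v₁ T)) ∞ surf ≤
      ∑ j ∈ Finset.range m, A j *
        eLpNorm (flowSum ψ (J j) v₀ v₁ T) (ENNReal.ofReal (2 * k)) surf := by
    intro T
    rw [lowProj_of_hasSum e (hasSum_linFlow e (hv T)), eLpNorm_congr_ae (coeFn_sum_smul he _ _)]
    have hsum : (fun x => ∑ i ∈ modes 0 M, flowCoeff v₀ v₁ T i * ψ i x) =
        ∑ j ∈ Finset.range m, flowSum ψ (J j) v₀ v₁ T := by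
      funext x
      rw [Finset.sum_apply, ← Finset.sum_fiberwise_of_maps_to (g := g) (t := Finset.range m)
        fun i hi => Finset.mem_range.2 (hg i hi)]
      rfl
    rw [hsum]
    refine (eLpNorm_sum_le (fun j _ => (hfm j).of_uncurry_left.aestronglyMeasurable) le_top).trans ?_
    refine Finset.sum_le_sum fun j _ => eLpNorm_top_flowSum_le hψ hQ hK (fun i hi => ?_) _ _ _
    obtain ⟨hi1, rfl⟩ := Finset.mem_filter.1 hi
    exact hD i hi1
  have h1 := weightedNorm_le (s := 1) le_rfl ∞ (F := fun T => lowProj e M (linFlow e v₀ v₁ T))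
    (Finset.measurable_sum _ fun j _ => (hm j).const_mul (A j)) hpt
  rw [div_one, ENNReal.ofReal_one] at h1
  refine h1.trans_eq ?_
  rw [eLpNorm_one_eq_lintegral_enorm]
  simp only [enorm_eq_self]
  rw [lintegral_finsetSum _ fun j _ => (hm j).const_mul (A j)]
  refine Finset.sum_congr rfl fun j _ => ?_
  rw [lintegral_const_mul _ (hm j), mixedNorm, ENNReal.ofReal_one, eLpNorm_one_eq_lintegral_enorm]
  rfl

theorem sum_range_two_rpow_le {σ : ℝ} (hσ : 0 < σ) :
    ∃ G : ℝ, 0 < G ∧ ∀ m : ℕ, ∑ j ∈ Finset.range m, ((2 : ℝ) ^ (-(σ / 2))) ^ j ≤ G := by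
  have h1 : (2 : ℝ) ^ (-(σ / 2)) < 1 := Real.rpow_lt_one_of_one_lt_of_neg one_lt_two (by linarith)
  have h0 : (0 : ℝ) ≤ 2 ^ (-(σ / 2)) := by positivity
  refine ⟨(1 - (2 : ℝ) ^ (-(σ / 2)))⁻¹, inv_pos.2 (by linarith), fun m => ?_⟩
  rw [← tsum_geometric_of_lt_one h0 h1]
  exact (summable_geometric_of_lt_one h0 h1).sum_le_tsum _ fun j _ => by positivity

/-- The frequency blocks used to bound the sup norm: one block if `σ = 0`, dyadic blocks
otherwise. -/
theorem exists_blocks {σ : ℝ} (hσ : 0 ≤ σ) :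
    ∃ k : ℕ, 1 ≤ k ∧ ∃ G : ℝ, 0 < G ∧ ∀ M : ℕ, 1 ≤ M →
      ∃ (m : ℕ) (g : ModeIdx → ℕ) (D : ℕ → ℕ) (θ : ℕ → ℝ),
        (∀ i ∈ modes 0 M, g i < m) ∧ (∀ i ∈ modes 0 M, i.1 ≤ D (g i)) ∧ (∀ j, 0 < θ j) ∧
        (∀ u₀ u₁, ∀ i ∈ modes 0 M,
          modeVar u₀ u₁ i ≤ θ (g i) ^ 2 * modeWeight σ u₀ u₁ i) ∧
        ∑ j ∈ Finset.range m, ((D j : ℝ) + 1) ^ (2 / k : ℝ) * θ j ≤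
          G * √((M : ℝ) ^ (if σ = 0 then 1 else 0 : ℕ)) := by
  rcases hσ.eq_or_lt with rfl | hσ
  -- With $k=4$ the Nikolskii loss is $(M+1)^{1/2}\le\sqrt2\,\sqrt M$.
  · refine ⟨4, by norm_num, √2, by positivity, fun M hM => ⟨1, fun _ => 0, fun _ => M, fun _ => 1,
      by simp, fun i hi => (mem_modes.1 hi).2, fun _ => one_pos, fun u₀ u₁ i _ => ?_, ?_⟩⟩
    · simpa using modeVar_le le_rfl u₀ u₁ i
    · have : (1 : ℝ) ≤ M := by exact_mod_cast hM
      simp only [Finset.range_one, Finset.sum_singleton, mul_one, if_true, pow_one]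
      rw [← Real.sqrt_mul zero_le_two, Nat.cast_ofNat, show (2 / 4 : ℝ) = 1 / 2 by norm_num,
        ← Real.sqrt_eq_rpow]
      exact Real.sqrt_le_sqrt (by linarith)
  · obtain ⟨G, hG, hGm⟩ := sum_range_two_rpow_le hσ
    -- The bound $k\ge4/\sigma$ gives $2/k\le\sigma/2$; the bound $k\ge4$ only serves to have
    -- $4^{2/k}\le4$.
    obtain ⟨k, hk⟩ := exists_nat_ge (max 4 (4 / σ))
    have hk4 : (4 : ℝ) ≤ k := (le_max_left _ _).trans hk
    have hkσ : 4 / σ ≤ k := (le_max_right _ _).trans hk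
    have hk0 : (0 : ℝ) < k := by linarith
    have hk1 : (2 / k : ℝ) ≤ 1 := by rw [div_le_one hk0]; linarith
    have hk2 : (2 / k : ℝ) ≤ σ / 2 := by
      rw [div_le_iff₀ hσ] at hkσ
      rw [div_le_iff₀ hk0]
      linarith
    -- Block $j$ is $2^j\le n<2^{j+1}$. There $n^{2\sigma}\ge2^{2j\sigma}$, whence
    -- $\theta_j=2^{-j\sigma}$, and the products are at most $4\cdot2^{-j\sigma/2}$. The number
    -- $M+1$ of blocks is generous, which is harmless for a convergent geometric series.
    refine ⟨k, by exact_mod_cast (by linarith : (1 : ℝ) ≤ k), 4 * G, by positivity, fun M hM =>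
      ⟨M + 1, fun i => Nat.log 2 i.1, fun j => 2 ^ (j + 1), fun j => (2 : ℝ) ^ (-(j * σ)),
      fun i hi => ?_, fun i hi => ?_, fun j => by positivity, fun u₀ u₁ i hi => ?_, ?_⟩⟩
    · exact Nat.lt_succ_of_le ((Nat.log_le_self 2 _).trans (mem_modes.1 hi).2)
    · exact (Nat.lt_pow_succ_log_self one_lt_two _).le
    · rw [modeWeight_eq, ← mul_assoc]
      refine le_mul_of_one_le_left (modeVar_nonneg _ _ _) ?_
      have h1 : (2 : ℝ) ^ (Nat.log 2 i.1 : ℝ) ≤ i.1 := by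
        rw [Real.rpow_natCast]
        exact_mod_cast Nat.pow_log_le_self 2 (by have := i.one_le; omega)
      calc (1 : ℝ) = ((2 : ℝ) ^ (-((Nat.log 2 i.1 : ℝ) * σ))) ^ 2 *
            ((2 : ℝ) ^ (Nat.log 2 i.1 : ℝ)) ^ (2 * σ) := by
            rw [← Real.rpow_natCast, ← Real.rpow_mul zero_le_two, ← Real.rpow_mul zero_le_two,
              ← Real.rpow_add zero_lt_two]
            push_cast
            ring_nf
            simp
        _ ≤ _ := by gcongr
    · rw [if_neg hσ.ne', pow_zero, Real.sqrt_one, mul_one]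
      refine le_trans ?_ (mul_le_mul_of_nonneg_left (hGm (M + 1)) (by norm_num : (0 : ℝ) ≤ 4))
      rw [Finset.mul_sum]
      refine Finset.sum_le_sum fun j _ => ?_
      have h1 : (((2 ^ (j + 1) : ℕ) : ℝ) + 1) ^ (2 / k : ℝ) ≤ 4 * (2 : ℝ) ^ (j * (σ / 2)) := by
        have h2 : ((2 ^ (j + 1) : ℕ) : ℝ) + 1 ≤ 4 * (2 : ℝ) ^ (j : ℝ) := by
          have : (1 : ℝ) ≤ 2 ^ j := one_le_pow₀ one_le_two
          rw [Real.rpow_natCast]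
          push_cast
          rw [pow_succ]
          linarith
        calc (((2 ^ (j + 1) : ℕ) : ℝ) + 1) ^ (2 / k : ℝ)
            ≤ (4 * (2 : ℝ) ^ (j : ℝ)) ^ (2 / k : ℝ) := by gcongr
          _ = 4 ^ (2 / k : ℝ) * (2 : ℝ) ^ (j * (2 / k : ℝ)) := by
              rw [Real.mul_rpow (by norm_num) (by positivity), ← Real.rpow_mul zero_le_two]
          _ ≤ 4 ^ (1 : ℝ) * (2 : ℝ) ^ (j * (σ / 2)) := by
              gcongr
              · norm_num
              · norm_num
          _ = _ := by rw [Real.rpow_one]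
      calc _ ≤ 4 * (2 : ℝ) ^ (j * (σ / 2)) * (2 : ℝ) ^ (-(j * σ)) := by gcongr
        _ = _ := by
          rw [mul_assoc, ← Real.rpow_add zero_lt_two, ← Real.rpow_natCast,
            ← Real.rpow_mul zero_le_two]
          ring_nf

/-! ### Large deviation estimates -/

theorem hasSubgaussianMGF_of_integral_le {Ω : Type*} [MeasurableSpace Ω] {P : Measure Ω}
    {X : Ω → ℝ} {κ : ℝ} {c : NNReal} (hc : 2 * κ ≤ c)
    (h : ∀ γ : ℝ, Integrable (fun ω => Real.exp (γ * X ω)) P ∧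
      ∫ ω, Real.exp (γ * X ω) ∂P ≤ Real.exp (κ * γ ^ 2)) : HasSubgaussianMGF X c P where
  integrable_exp_mul t := (h t).1
  mgf_le t := (h t).2.trans (Real.exp_le_exp.2 (by nlinarith [sq_nonneg t]))

/-- Monotonicity of the outer measure suffices, so `W`, later the norm of the random flow, need not
be measurable. -/
theorem measureReal_ge_mono_ae {Ω : Type*} [MeasurableSpace Ω] {P : Measure Ω} [IsFiniteMeasure P]
    {W V : Ω → ℝ≥0∞} (h : ∀ᵐ ω ∂P, W ω ≤ V ω) (t : ℝ≥0∞) :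
    P.real {ω | t ≤ W ω} ≤ P.real {ω | t ≤ V ω} := by
  refine ENNReal.toReal_mono (measure_ne_top _ _) (measure_mono_ae ?_)
  filter_upwards [h] with ω hω hω'
  exact le_trans hω' hω

/-- The constant in the moment estimates. -/
noncomputable def momentConst (c : NNReal) (B : ℝ) : ℝ :=
  2 * √(c + 1) * Real.pi * volBound * √(B ^ 2 + volBound)

theorem momentConst_pos (c : NNReal) (B : ℝ) : 0 < momentConst c B := by
  have := one_le_volBound
  have := Real.pi_pos
  unfold momentConst
  positivity

theorem modes_sum_modeVar_le {σ : ℝ} (hσ : 0 ≤ σ) {u₀ u₁ : ModeIdx → ℝ} (h₀ : MemSobolev σ u₀)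
    (h₁ : MemSobolev (σ - 1) u₁) (N L : ℕ) :
    ∑ i ∈ modes N L, modeVar u₀ u₁ i ≤ tailSum σ u₀ u₁ N :=
  (Finset.sum_le_sum fun i _ => modeVar_le hσ u₀ u₁ i).trans
    (sum_modeWeight_le_tailSum h₀ h₁ _ fun _ hi => (mem_modes.1 hi).1)

section Probability

variable {Ω : Type*} [MeasurableSpace Ω] {P : Measure Ω} [IsProbabilityMeasure P]
  {a b : ModeIdx → Ω → ℝ}

/-- Fatou in $\omega$, with moment bounds uniform in the truncation. A separate `D` is kept because
the tail sum may vanish while the moment bound requires positivity. -/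
theorem eLpNorm_liminf_mixedNorm_le
    (ham : ∀ i, Measurable (a i)) (hbm : ∀ i, Measurable (b i))
    (hind : iIndepFun (fun j : ModeIdx ⊕ ModeIdx => Sum.elim a b j) P) {c : NNReal}
    (ha : ∀ i, HasSubgaussianMGF (a i) c P) (hb : ∀ i, HasSubgaussianMGF (b i) c P)
    {σ : ℝ} (hσ : 0 ≤ σ) {u₀ u₁ : ModeIdx → ℝ} (h₀ : MemSobolev σ u₀)
    (h₁ : MemSobolev (σ - 1) u₁) {ψ : ModeIdx → S3 → ℝ} (hψ : ∀ i, Measurable (ψ i))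
    (N : ℕ) {D : ℝ} (hD : 0 < D) (hSD : tailSum σ u₀ u₁ N ≤ D)
    {s r q B : ℝ} (hs : 1 ≤ s) (hsr : s ≤ r) (hrq : r ≤ q) (hB : 0 ≤ B)
    (hψB : ∀ i, eLpNorm (ψ i) (ENNReal.ofReal (max r 2)) surf ≤ ENNReal.ofReal B) :
    eLpNorm (fun ω => liminf (fun L => mixedNorm s r
      (flowSum ψ (modes N L) (fun i => u₀ i * a i ω) (fun i => u₁ i * b i ω))) atTop)
        (ENNReal.ofReal q) P ≤ ENNReal.ofReal (momentConst c B * √q * √D) := by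
  refine (eLpNorm_liminf_le (fun L => measurable_mixedNorm_flowSum hψ _
    (v₀ := fun i ω => u₀ i * a i ω) (v₁ := fun i ω => u₁ i * b i ω)
    (fun i => (ham i).const_mul _) (fun i => (hbm i).const_mul _) (by linarith)
    (by linarith)) (by linarith)).trans ?_
  refine (liminf_le_liminf (Eventually.of_forall fun L => eLpNorm_mixedNorm_flowSum_le ham hbm hind
    ha hb u₀ u₁ hψ (modes N L) hD ((modes_sum_modeVar_le hσ h₀ h₁ N L).trans hSD) hs hsr hrq hB
    hψB)).trans_eq ?_
  rw [liminf_const, momentConst]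

theorem measure_weightedNorm_tail_le {e : HilbertBasis ModeIdx ℝ L2S3}
    (ham : ∀ i, Measurable (a i)) (hbm : ∀ i, Measurable (b i))
    (hind : iIndepFun (fun j : ModeIdx ⊕ ModeIdx => Sum.elim a b j) P) {c : NNReal}
    (ha : ∀ i, HasSubgaussianMGF (a i) c P) (hb : ∀ i, HasSubgaussianMGF (b i) c P)
    {σ : ℝ} (hσ : 0 ≤ σ) {u₀ u₁ : ModeIdx → ℝ} (h₀ : MemSobolev σ u₀)
    (h₁ : MemSobolev (σ - 1) u₁) {ψ : ModeIdx → S3 → ℝ} (hψ : ∀ i, Measurable (ψ i))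
    (he : ∀ i, (e i : S3 → ℝ) =ᵐ[surf] ψ i) (N : ℕ) {p B : ℝ} (hp : 1 ≤ p) (hB : 0 ≤ B)
    (hψB : ∀ i, eLpNorm (ψ i) (ENNReal.ofReal (max p 2)) surf ≤ ENNReal.ofReal B)
    {lam : ℝ} (hlam : 0 < lam) :
    P.real {ω | ENNReal.ofReal lam ≤
        weightedNorm (2 / p) (ENNReal.ofReal p) (ENNReal.ofReal p) fun T =>
          linFlow e (fun i => u₀ i * a i ω) (fun i => u₁ i * b i ω) T -
            lowProj e N (linFlow e (fun i => u₀ i * a i ω) (fun i => u₁ i * b i ω) T)}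
      ≤ (momentConst c B * √p * √(tailSum σ u₀ u₁ N) / lam) ^ p := by
  have hS := tailSum_nonneg σ u₀ u₁ N
  have hA := momentConst_pos c B
  have hae : ∀ᵐ ω ∂P, weightedNorm (2 / p) (ENNReal.ofReal p) (ENNReal.ofReal p) (fun T =>
        linFlow e (fun i => u₀ i * a i ω) (fun i => u₁ i * b i ω) T -
          lowProj e N (linFlow e (fun i => u₀ i * a i ω) (fun i => u₁ i * b i ω) T)) ≤
      liminf (fun L => mixedNorm p p
        (flowSum ψ (modes N L) (fun i => u₀ i * a i ω) (fun i => u₁ i * b i ω))) atTop := by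
    filter_upwards [ae_memSobolev_mul ham ha h₀, ae_memSobolev_mul hbm hb h₁] with ω hω₀ hω₁
    exact weightedNorm_le_liminf hψ he hp (by linarith) fun T =>
      tendsto_sum_modes e (hasSum_linFlow e (summable_flowCoeff_sq hσ hω₀ hω₁ T)) N
  have hmeas : Measurable fun ω => liminf (fun L => mixedNorm p p
      (flowSum ψ (modes N L) (fun i => u₀ i * a i ω) (fun i => u₁ i * b i ω))) atTop :=
    Measurable.liminf fun L => measurable_mixedNorm_flowSum hψ _
      (v₀ := fun i ω => u₀ i * a i ω) (v₁ := fun i ω => u₁ i * b i ω)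
      (fun i => (ham i).const_mul _) (fun i => (hbm i).const_mul _) (by linarith) (by linarith)
  refine (measureReal_ge_mono_ae hae _).trans ?_
  -- The tail sum may be zero, so the estimate is applied with the tail sum plus $\varepsilon$ and
  -- $\varepsilon\to0^+$.
  have hcont : Continuous fun ε : ℝ =>
      (momentConst c B * √p * √(tailSum σ u₀ u₁ N + ε) / lam) ^ p :=
    Continuous.rpow_const (by fun_prop) fun _ => Or.inr (by linarith)
  have hlim := (hcont.tendsto 0).mono_left (nhdsWithin_le_nhds (s := Set.Ioi 0))
  rw [add_zero] at hlim
  refine ge_of_tendsto hlim ?_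
  filter_upwards [self_mem_nhdsWithin] with ε hε
  have hε : 0 < ε := hε
  exact measure_ge_le_of_eLpNorm_le hmeas (by linarith) (by positivity) hlam
    (eLpNorm_liminf_mixedNorm_le ham hbm hind ha hb hσ h₀ h₁ hψ N (by linarith) (by linarith) hp
      le_rfl le_rfl hB hψB)

theorem measure_weightedNorm_flow_le {e : HilbertBasis ModeIdx ℝ L2S3}
    (ham : ∀ i, Measurable (a i)) (hbm : ∀ i, Measurable (b i))
    (hind : iIndepFun (fun j : ModeIdx ⊕ ModeIdx => Sum.elim a b j) P) {c : NNReal}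
    (ha : ∀ i, HasSubgaussianMGF (a i) c P) (hb : ∀ i, HasSubgaussianMGF (b i) c P)
    {σ : ℝ} (hσ : 0 ≤ σ) {u₀ u₁ : ModeIdx → ℝ} (h₀ : MemSobolev σ u₀)
    (h₁ : MemSobolev (σ - 1) u₁) {ψ : ModeIdx → S3 → ℝ} (hψ : ∀ i, Measurable (ψ i))
    (he : ∀ i, (e i : S3 → ℝ) =ᵐ[surf] ψ i) {s r B : ℝ} (hs : 1 ≤ s) (hsr : s ≤ r) (hB : 0 ≤ B)
    (hψB : ∀ i, eLpNorm (ψ i) (ENNReal.ofReal (max r 2)) surf ≤ ENNReal.ofReal B)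
    (hS : 0 < tailSum σ u₀ u₁ 0) {lam : ℝ} (hlam : 0 ≤ lam) :
    P.real {ω | ENNReal.ofReal lam ≤
        weightedNorm (2 / s) (ENNReal.ofReal s) (ENNReal.ofReal r) fun T =>
          linFlow e (fun i => u₀ i * a i ω) (fun i => u₁ i * b i ω) T}
      ≤ Real.exp r * Real.exp (-(Real.exp (-2) * lam ^ 2 /
          (momentConst c B * √(tailSum σ u₀ u₁ 0)) ^ 2)) := by
  have hA := momentConst_pos c B
  have hae : ∀ᵐ ω ∂P, weightedNorm (2 / s) (ENNReal.ofReal s) (ENNReal.ofReal r) (fun T =>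
        linFlow e (fun i => u₀ i * a i ω) (fun i => u₁ i * b i ω) T) ≤
      liminf (fun L => mixedNorm s r
        (flowSum ψ (modes 0 L) (fun i => u₀ i * a i ω) (fun i => u₁ i * b i ω))) atTop := by
    filter_upwards [ae_memSobolev_mul ham ha h₀, ae_memSobolev_mul hbm hb h₁] with ω hω₀ hω₁
    exact weightedNorm_le_liminf hψ he hs (by linarith) fun T =>
      (hasSum_linFlow e (summable_flowCoeff_sq hσ hω₀ hω₁ T)).comp tendsto_modes_zero
  have hmeas : Measurable fun ω => liminf (fun L => mixedNorm s r
      (flowSum ψ (modes 0 L) (fun i => u₀ i * a i ω) (fun i => u₁ i * b i ω))) atTop :=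
    Measurable.liminf fun L => measurable_mixedNorm_flowSum hψ _
      (v₀ := fun i ω => u₀ i * a i ω) (v₁ := fun i ω => u₁ i * b i ω)
      (fun i => (ham i).const_mul _) (fun i => (hbm i).const_mul _) (by linarith) (by linarith)
  refine (measureReal_ge_mono_ae hae _).trans
    (measure_ge_le_exp_of_eLpNorm_le hmeas (by linarith) (by positivity) (fun q hq => ?_) hlam)
  refine (eLpNorm_liminf_mixedNorm_le ham hbm hind ha hb hσ h₀ h₁ hψ 0 hS le_rfl hs
    hsr hq hB hψB).trans_eq ?_
  congr 1
  ring

/-- Each block has moments $O(\theta_j\sqrt{qS})$; the triangle inequality in $L^q(P)$ adds them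
with their Nikolskii factors, and the sum still grows like $\sqrt q$, which yields the Gaussian
tail. -/
theorem measure_weightedNorm_lowProj_le {e : HilbertBasis ModeIdx ℝ L2S3}
    (ham : ∀ i, Measurable (a i)) (hbm : ∀ i, Measurable (b i))
    (hind : iIndepFun (fun j : ModeIdx ⊕ ModeIdx => Sum.elim a b j) P) {c : NNReal}
    (ha : ∀ i, HasSubgaussianMGF (a i) c P) (hb : ∀ i, HasSubgaussianMGF (b i) c P)
    {σ : ℝ} (hσ : 0 ≤ σ) {u₀ u₁ : ModeIdx → ℝ} (h₀ : MemSobolev σ u₀)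
    (h₁ : MemSobolev (σ - 1) u₁) {ψ : ModeIdx → S3 → ℝ} (hψm : ∀ i, Measurable (ψ i))
    (he : ∀ i, (e i : S3 → ℝ) =ᵐ[surf] ψ i) {Q : ModeIdx → MvPolynomial (Fin 4) ℝ}
    (hψ : ∀ i, ψ i = polyS (Q i)) (hQ : ∀ i, (Q i).totalDegree ≤ i.1 - 1) {k : ℕ} (hk : 1 ≤ k)
    {K : ℝ} (hK0 : 0 < K)
    (hK : ∀ (D : ℕ) (Q : MvPolynomial (Fin 4) ℝ), Q.totalDegree ≤ D →
      eLpNorm (polyS Q) ∞ surf ≤ ENNReal.ofReal (K * ((D : ℝ) + 1) ^ (2 / k : ℝ)) *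
        eLpNorm (polyS Q) (ENNReal.ofReal (2 * k)) surf)
    {B : ℝ} (hB : 0 ≤ B)
    (hψB : ∀ i, eLpNorm (ψ i) (ENNReal.ofReal (max (2 * k) 2)) surf ≤ ENNReal.ofReal B)
    (hS : 0 < tailSum σ u₀ u₁ 0) {M m : ℕ} {g : ModeIdx → ℕ} (hg : ∀ i ∈ modes 0 M, g i < m)
    {D : ℕ → ℕ} (hD : ∀ i ∈ modes 0 M, i.1 ≤ D (g i)) {θ : ℕ → ℝ} (hθ : ∀ j, 0 < θ j)
    (hθu : ∀ i ∈ modes 0 M, modeVar u₀ u₁ i ≤ θ (g i) ^ 2 * modeWeight σ u₀ u₁ i)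
    {G : ℝ} (hG0 : 0 < G) (hG : ∑ j ∈ Finset.range m, ((D j : ℝ) + 1) ^ (2 / k : ℝ) * θ j ≤ G)
    {lam : ℝ} (hlam : 0 ≤ lam) :
    P.real {ω | ENNReal.ofReal lam ≤ weightedNorm 2 1 ∞ fun T =>
        lowProj e M (linFlow e (fun i => u₀ i * a i ω) (fun i => u₁ i * b i ω) T)}
      ≤ Real.exp (2 * k) * Real.exp (-(Real.exp (-2) * lam ^ 2 /
          (K * momentConst c B * G * √(tailSum σ u₀ u₁ 0)) ^ 2)) := by
  have hA := momentConst_pos c B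
  have hk1 : (1 : ℝ) ≤ k := by exact_mod_cast hk
  set S := tailSum σ u₀ u₁ 0 with hSdef
  set J : ℕ → Finset ModeIdx := fun j => (modes 0 M).filter fun i => g i = j with hJ
  set V : ℕ → Ω → ℝ≥0∞ := fun j ω => mixedNorm 1 (2 * k)
    (flowSum ψ (J j) (fun i => u₀ i * a i ω) (fun i => u₁ i * b i ω)) with hV
  have hVm : ∀ j, Measurable (V j) := fun j => measurable_mixedNorm_flowSum hψm _
    (v₀ := fun i ω => u₀ i * a i ω) (v₁ := fun i ω => u₁ i * b i ω)
    (fun i => (ham i).const_mul _) (fun i => (hbm i).const_mul _) one_pos (by linarith)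
  set A : ℕ → ℝ := fun j => K * ((D j : ℝ) + 1) ^ (2 / k : ℝ) with hAdef
  have hA0 : ∀ j, 0 ≤ A j := fun j => by positivity
  have hae : ∀ᵐ ω ∂P, weightedNorm 2 1 ∞ (fun T =>
        lowProj e M (linFlow e (fun i => u₀ i * a i ω) (fun i => u₁ i * b i ω) T)) ≤
      (∑ j ∈ Finset.range m, fun ω => ENNReal.ofReal (A j) * V j ω) ω := by
    filter_upwards [ae_memSobolev_mul ham ha h₀, ae_memSobolev_mul hbm hb h₁] with ω hω₀ hω₁
    rw [Finset.sum_apply]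
    exact weightedNorm_lowProj_le hψm he hψ hQ hk hK hg hD fun T =>
      summable_flowCoeff_sq hσ hω₀ hω₁ T
  have hVm' : ∀ j, Measurable fun ω => ENNReal.ofReal (A j) * V j ω := fun j =>
    (hVm j).const_mul _
  refine (measureReal_ge_mono_ae hae _).trans (measure_ge_le_exp_of_eLpNorm_le
    (B := K * momentConst c B * G * √S) (by fun_prop) (by linarith) (by positivity)
    (fun q hq => ?_) hlam)
  have hq0 : 0 < q := by linarith
  refine (eLpNorm_sum_le (fun j _ => (hVm' j).aestronglyMeasurable)
    (by simpa using (by linarith : (1 : ℝ) ≤ q))).trans ?_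
  have hterm : ∀ j, eLpNorm (fun ω => ENNReal.ofReal (A j) * V j ω) (ENNReal.ofReal q) P ≤
      ENNReal.ofReal (K * momentConst c B * √S * √q * (((D j : ℝ) + 1) ^ (2 / k : ℝ) * θ j)) := by
    intro j
    have h1 : eLpNorm (fun ω => ENNReal.ofReal (A j) * V j ω) (ENNReal.ofReal q) P =
        ENNReal.ofReal (A j) * eLpNorm (V j) (ENNReal.ofReal q) P := by
      rw [eLpNorm_ofReal_eq _ hq0, eLpNorm_ofReal_eq _ hq0]
      simp only [enorm_eq_self, ENNReal.mul_rpow_of_nonneg _ _ hq0.le]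
      rw [lintegral_const_mul' _ _ (ENNReal.rpow_ne_top_of_nonneg hq0.le ENNReal.ofReal_ne_top),
        ENNReal.mul_rpow_of_nonneg _ _ (by positivity), ← ENNReal.rpow_mul,
        mul_one_div_cancel hq0.ne', ENNReal.rpow_one]
    have hsum : ∑ i ∈ J j, modeVar u₀ u₁ i ≤ θ j ^ 2 * S := by
      calc ∑ i ∈ J j, modeVar u₀ u₁ i ≤ ∑ i ∈ J j, θ j ^ 2 * modeWeight σ u₀ u₁ i := by
            refine Finset.sum_le_sum fun i hi => ?_
            obtain ⟨hi1, rfl⟩ := Finset.mem_filter.1 hi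
            exact hθu i hi1
        _ ≤ _ := by
            rw [← Finset.mul_sum]
            refine mul_le_mul_of_nonneg_left (sum_modeWeight_le_tailSum h₀ h₁ _ fun i _ => ?_)
              (sq_nonneg _)
            exact i.one_le
    have hθj := hθ j
    have h2 := eLpNorm_mixedNorm_flowSum_le ham hbm hind ha hb u₀ u₁ hψm (J j)
      (D := θ j ^ 2 * S) (by positivity) hsum le_rfl (by linarith : (1 : ℝ) ≤ 2 * k) hq hB hψB
    rw [h1]
    refine (mul_le_mul_right h2 _).trans_eq ?_
    rw [← ENNReal.ofReal_mul (hA0 j), Real.sqrt_mul (sq_nonneg _), Real.sqrt_sq hθj.le, hAdef,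
      momentConst]
    congr 1
    ring
  refine (Finset.sum_le_sum fun j _ => hterm j).trans ?_
  rw [← ENNReal.ofReal_sum_of_nonneg fun j _ => by have := hθ j; positivity, ← Finset.mul_sum]
  refine ENNReal.ofReal_le_ofReal ((mul_le_mul_of_nonneg_left hG (by positivity)).trans_eq ?_)
  ring

end Probability

/-- Uniform bounds of the basis in `L^r` for finite `r`. -/
theorem exists_eLpNorm_basis_le {e : HilbertBasis ModeIdx ℝ L2S3} {p : ℕ → ℝ}
    (hp : Tendsto p atTop atTop) {C₀ : ℝ} (hbound : ∀ m i,
      eLpNorm (e i : S3 → ℝ) (ENNReal.ofReal (p m)) surf ≤ ENNReal.ofReal (C₀ * √(p m)))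
    {r : ℝ} (hr : 1 ≤ r) :
    ∃ B : ℝ, 0 ≤ B ∧ ∀ i, eLpNorm (e i : S3 → ℝ) (ENNReal.ofReal r) surf ≤ ENNReal.ofReal B := by
  -- Some $p_m$ exceeds $r$; Hölder on the finite measure descends from $p_m$ to $r$.
  obtain ⟨m, hm⟩ := (hp.eventually_ge_atTop r).exists
  have hv := one_le_volBound
  refine ⟨max (C₀ * √(p m)) 0 * volBound, by positivity, fun i => ?_⟩
  refine (eLpNorm_le_eLpNorm_mul_rpow_measure_univ (ENNReal.ofReal_le_ofReal hm)
    (Lp.aestronglyMeasurable (e i))).trans ?_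
  rw [ENNReal.ofReal_mul (le_max_right _ _)]
  gcongr
  · exact (hbound m i).trans (ENNReal.ofReal_le_ofReal (le_max_left _ _))
  · rw [ENNReal.toReal_ofReal (by linarith), ENNReal.toReal_ofReal (by linarith)]
    refine surf_univ_rpow_le ?_ ?_
    · rw [sub_nonneg]
      exact one_div_le_one_div_of_le (by linarith) hm
    · have h1 : 1 / r ≤ 1 := (div_le_one (by linarith)).2 hr
      have h2 : 0 ≤ 1 / p m := one_div_nonneg.2 (by linarith)
      linarith

/-- For $p<2$ the $L^2$ norm is used instead; it equals 1 and is absorbed by $\max(C_0,1)$. -/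
theorem eLpNorm_basis_max_two_le {e : HilbertBasis ModeIdx ℝ L2S3} {p C₀ : ℝ} (hp : 1 ≤ p)
    (hbound : ∀ i, eLpNorm (e i : S3 → ℝ) (ENNReal.ofReal p) surf ≤ ENNReal.ofReal (C₀ * √p))
    (i : ModeIdx) :
    eLpNorm (e i : S3 → ℝ) (ENNReal.ofReal (max p 2)) surf ≤
      ENNReal.ofReal (max C₀ 1 * √p) := by
  have h1 : 1 ≤ √p := Real.one_le_sqrt.2 hp
  rcases le_total 2 p with h | h
  · rw [max_eq_left h]
    refine (hbound i).trans (ENNReal.ofReal_le_ofReal ?_)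
    gcongr
    exact le_max_left _ _
  · rw [max_eq_right h, ENNReal.ofReal_ofNat, ← ENNReal.ofReal_toReal (Lp.eLpNorm_ne_top (e i)),
      ← Lp.norm_def, e.orthonormal.1 i]
    refine ENNReal.ofReal_le_ofReal ?_
    have := le_max_right C₀ 1
    nlinarith

theorem mainTheorem4 (σ : ℝ) (hσ₀ : 0 ≤ σ) (hσ₁ : σ < 1 / 2)
    (e : HilbertBasis ModeIdx ℝ L2S3)
    (he : ∀ i : ModeIdx, IsSphericalHarmonic (i.1 - 1) (e i))
    (p : ℕ → ℝ) (hp₁ : ∀ m, 1 ≤ p m) (hp : Tendsto p atTop atTop)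
    (hbound : ∃ C₀ : ℝ, ∀ m i,
      eLpNorm (e i : S3 → ℝ) (ENNReal.ofReal (p m)) surf ≤ ENNReal.ofReal (C₀ * √(p m)))
    (κ : ℝ) :
    ∃ C : ℝ, 0 < C ∧ ∃ c : ℝ, 0 < c ∧
      ∀ {Ω : Type*} [MeasurableSpace Ω] (P : Measure Ω) [IsProbabilityMeasure P]
        (a b : ModeIdx → Ω → ℝ),
        (∀ i, Measurable (a i)) → (∀ i, Measurable (b i)) →
        iIndepFun (fun j : ModeIdx ⊕ ModeIdx => Sum.elim a b j) P →
        (∀ i (γ : ℝ), Integrable (fun ω => Real.exp (γ * a i ω)) P ∧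
          ∫ ω, Real.exp (γ * a i ω) ∂P ≤ Real.exp (κ * γ ^ 2)) →
        (∀ i (γ : ℝ), Integrable (fun ω => Real.exp (γ * b i ω)) P ∧
          ∫ ω, Real.exp (γ * b i ω) ∂P ≤ Real.exp (κ * γ ^ 2)) →
      ∀ u₀ u₁ : ModeIdx → ℝ, MemSobolev σ u₀ → MemSobolev (σ - 1) u₁ →
        (∃ i, u₀ i ≠ 0 ∨ u₁ i ≠ 0) →
        (∀ᵐ ω ∂P, MemSobolev σ (fun i => u₀ i * a i ω) ∧
          MemSobolev (σ - 1) (fun i => u₁ i * b i ω)) ∧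
        (∀ (lam : ℝ), 0 < lam → ∀ (N m : ℕ),
          P.real {ω | ENNReal.ofReal lam ≤
              weightedNorm (2 / p m) (ENNReal.ofReal (p m)) (ENNReal.ofReal (p m)) fun T =>
                linFlow e (fun i => u₀ i * a i ω) (fun i => u₁ i * b i ω) T -
                  lowProj e N (linFlow e (fun i => u₀ i * a i ω) (fun i => u₁ i * b i ω) T)}
            ≤ (C * p m * √(tailSum σ u₀ u₁ N) / lam) ^ p m) ∧
        (∀ (lam : ℝ), 0 ≤ lam →
          P.real {ω | ENNReal.ofReal lam ≤
              weightedNorm (2 / 3) 3 6 fun T =>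
                linFlow e (fun i => u₀ i * a i ω) (fun i => u₁ i * b i ω) T}
            ≤ C * Real.exp (-c * lam ^ 2 / tailSum σ u₀ u₁ 0)) ∧
        (∀ (lam : ℝ), 0 ≤ lam → ∀ M : ℕ, 1 ≤ M →
          P.real {ω | ENNReal.ofReal lam ≤
              weightedNorm 2 1 ∞ fun T =>
                lowProj e M (linFlow e (fun i => u₀ i * a i ω) (fun i => u₁ i * b i ω) T)}
            ≤ C * Real.exp (-c * lam ^ 2 /
                ((M : ℝ) ^ (if σ = 0 then 1 else 0 : ℕ) * tailSum σ u₀ u₁ 0))) := by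
  obtain ⟨C₀, hbound⟩ := hbound
  choose Q hQh _ hQe using he
  have hQ : ∀ i, (Q i).totalDegree ≤ i.1 - 1 := fun i => (hQh i).totalDegree_le
  let ψ : ModeIdx → S3 → ℝ := fun i => polyS (Q i)
  have hψ : ∀ i, ψ i = polyS (Q i) := fun _ => rfl
  have hψm : ∀ i, Measurable (ψ i) := fun i => (polyS (Q i)).continuous.measurable
  have he : ∀ i, (e i : S3 → ℝ) =ᵐ[surf] ψ i := fun i => by
    filter_upwards [hQe i] with x hx
    rw [hx, hψ, polyS_apply]
  -- The factor 2 matches the convention $e^{ct^2/2}$ for the proxy; the absolute value gives a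
  -- nonnegative proxy for every real $\kappa$.
  let c : NNReal := ⟨2 * |κ|, by positivity⟩
  have hc : 2 * κ ≤ c := mul_le_mul_of_nonneg_left (le_abs_self κ) zero_le_two
  have hv := one_le_volBound
  have hpi := Real.pi_pos
  obtain ⟨B₆, hB₆, hψ₆⟩ := exists_eLpNorm_basis_le hp hbound (r := max 6 2) (by norm_num)
  obtain ⟨k, hk, G, hG, hblocks⟩ := exists_blocks hσ₀
  have hk1 : (1 : ℝ) ≤ k := by exact_mod_cast hk
  obtain ⟨K, hK0, hK⟩ := exists_eLpNorm_top_polyS_le hk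
  obtain ⟨B, hB, hψB⟩ := exists_eLpNorm_basis_le hp hbound (r := max (2 * k) 2)
    (le_max_of_le_right one_le_two)
  set C₁ := 2 * √(c + 1) * Real.pi * volBound * √(max C₀ 1 ^ 2 + volBound) with hC₁
  have hC₁0 : 0 ≤ C₁ := by positivity
  set A₂ := momentConst c B₆ with hA₂
  have hA₂0 : 0 < A₂ := momentConst_pos _ _
  set A₃ := K * momentConst c B * G with hA₃
  have hA₃0 : 0 < A₃ := by have := momentConst_pos c B; positivity
  set c' := min (Real.exp (-2) / A₂ ^ 2) (Real.exp (-2) / A₃ ^ 2) with hc'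
  refine ⟨C₁ + Real.exp 6 + Real.exp (2 * k), by positivity, c', by positivity, ?_⟩
  intro Ω _ P _ a b ham hbm hind ha hb u₀ u₁ h₀ h₁ hne
  have ha' : ∀ i, HasSubgaussianMGF (a i) c P := fun i =>
    hasSubgaussianMGF_of_integral_le hc (ha i)
  have hb' : ∀ i, HasSubgaussianMGF (b i) c P := fun i =>
    hasSubgaussianMGF_of_integral_le hc (hb i)
  have hS := tailSum_zero_pos h₀ h₁ hne
  refine ⟨(ae_memSobolev_mul ham ha' h₀).and (ae_memSobolev_mul hbm hb' h₁),
    fun lam hlam N m => ?_, fun lam hlam => ?_, fun lam hlam M hM => ?_⟩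
  · have hpm := hp₁ m
    have hψp : ∀ i, eLpNorm (ψ i) (ENNReal.ofReal (max (p m) 2)) surf ≤
        ENNReal.ofReal (max C₀ 1 * √(p m)) := fun i =>
      (eLpNorm_congr_ae (he i)).symm.le.trans (eLpNorm_basis_max_two_le hpm (hbound m) i)
    refine (measure_weightedNorm_tail_le ham hbm hind ha' hb' hσ₀ h₀ h₁ hψm he N hpm
      (by positivity) hψp hlam).trans ?_
    have hN := tailSum_nonneg σ u₀ u₁ N
    have hmc := momentConst_pos c (max C₀ 1 * √(p m))
    -- The basis bound $B=\max(C_0,1)\sqrt{p_m}$ makes `momentConst` grow like $\sqrt{p_m}$; with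
    -- the $\sqrt q$ of the moments at $q=p_m$ this gives the full power $p_m$.
    have hle : momentConst c (max C₀ 1 * √(p m)) * √(p m) ≤ C₁ * p m := by
      have h1 : √((max C₀ 1 * √(p m)) ^ 2 + volBound) ≤
          √(max C₀ 1 ^ 2 + volBound) * √(p m) := by
        rw [← Real.sqrt_mul (by positivity)]
        refine Real.sqrt_le_sqrt ?_
        rw [mul_pow, Real.sq_sqrt (by linarith)]
        nlinarith
      calc momentConst c (max C₀ 1 * √(p m)) * √(p m)
          ≤ 2 * √(c + 1) * Real.pi * volBound * (√(max C₀ 1 ^ 2 + volBound) * √(p m)) *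
            √(p m) := by unfold momentConst; gcongr
        _ = C₁ * (√(p m) * √(p m)) := by rw [hC₁]; ring
        _ = C₁ * p m := by rw [Real.mul_self_sqrt (by linarith)]
    have hle' : C₁ ≤ C₁ + Real.exp 6 + Real.exp (2 * k) := by
      have := Real.exp_pos 6
      have := Real.exp_pos (2 * k)
      linarith
    refine Real.rpow_le_rpow (by positivity) ?_ (by linarith)
    have hle'' := hle.trans (mul_le_mul_of_nonneg_right hle' (by linarith : 0 ≤ p m))
    exact div_le_div_of_nonneg_right (mul_le_mul_of_nonneg_right hle'' (Real.sqrt_nonneg _)) hlam.le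
  · have h6 : Real.exp 6 ≤ C₁ + Real.exp 6 + Real.exp (2 * k) := by
      have := Real.exp_pos (2 * k)
      linarith
    have hmain := measure_weightedNorm_flow_le (s := 3) (r := 6) ham hbm hind ha' hb' hσ₀ h₀ h₁
      hψm he (by norm_num) (by norm_num) hB₆
      (fun i => (eLpNorm_congr_ae (he i)).symm.le.trans (hψ₆ i)) hS hlam
    rw [ENNReal.ofReal_ofNat, ENNReal.ofReal_ofNat] at hmain
    refine hmain.trans ?_
    gcongr
    rw [mul_pow, Real.sq_sqrt hS.le, neg_mul, neg_div, neg_le_neg_iff, ← hA₂,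
      show Real.exp (-2) * lam ^ 2 / (A₂ ^ 2 * tailSum σ u₀ u₁ 0) =
        Real.exp (-2) / A₂ ^ 2 * lam ^ 2 / tailSum σ u₀ u₁ 0 by field_simp]
    gcongr
    exact min_le_left _ _
  · have h6 : Real.exp (2 * k) ≤ C₁ + Real.exp 6 + Real.exp (2 * k) := by
      have := Real.exp_pos 6
      linarith
    obtain ⟨m, g, D, θ, hg, hD, hθ, hθu, hsum⟩ := hblocks M hM
    have hM0 : (0 : ℝ) < M := by exact_mod_cast hM
    set Ms : ℝ := (M : ℝ) ^ (if σ = 0 then 1 else 0 : ℕ) with hMs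
    have hMs0 : 0 < Ms := by positivity
    refine (measure_weightedNorm_lowProj_le ham hbm hind ha' hb' hσ₀ h₀ h₁ hψm he hψ hQ hk hK0 hK
      hB (fun i => (eLpNorm_congr_ae (he i)).symm.le.trans (hψB i)) hS hg hD hθ (hθu u₀ u₁)
      (by positivity) hsum hlam).trans ?_
    gcongr
    rw [← mul_assoc, ← hA₃, mul_pow, mul_pow, Real.sq_sqrt hS.le, Real.sq_sqrt hMs0.le, neg_mul,
      neg_div, neg_le_neg_iff, show Real.exp (-2) * lam ^ 2 / (A₃ ^ 2 * Ms * tailSum σ u₀ u₁ 0) =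
        Real.exp (-2) / A₃ ^ 2 * lam ^ 2 / (Ms * tailSum σ u₀ u₁ 0) by field_simp]
    gcongr
    exact min_le_right _ _
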